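/- **Theorem (Faith-Shap).** Let $d\ge 1$ and $[d]=\{1,\dots,d\}$. An *interaction index* $\mathcal E$ assigns to every set function $v:2^{[d]}\to\mathbb R$ and every $\ell\in[d]$ a vector $\mathcal E(v,\ell)=(\mathcal E_S(v,\ell))_{S\subseteq[d],\,|S|\le\ell}$ of reals. A *proper weighting* is a function $\mu:2^{[d]}\to(0,\infty]$ with $\mu(S)<\infty$ whenever $1\le|S|\le d-1$. The index $\mathcal E$ is *given by* $\mu$ if for all $v$ and all $\ell\in[d]$ the vector $\mathcal E(v,\ell)$ minimizes $$\sum_{S\subseteq[d]:\,\mu(S)<\infty}\mu(S)\Big(v(S)-\sum_{T\subseteq S,\,|T|\le\ell}x_T\Big)^2\quad\text{subject to}\quad v(S)=\sum_{T\subseteq S,\,|T|\le\ell}x_T\ \text{ whenever }\mu(S)=\infty,$$ over all real vectors $x=(x_T)_{|T|\le\ell}$. It is a *Faith-Interaction index* if it is given by some proper weighting $\mu$ (one $\mu$ for all $v$ and $\ell$). Consider the following axioms, each required for all $\ell\in[d]$. * Interaction linearity: $\mathcal E(\alpha_1v_1+\alpha_2v_2,\ell)=\alpha_1\mathcal E(v_1,\ell)+\alpha_2\mathcal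 E(v_2,\ell)$ for all set functions $v_1,v_2$ and reals $\alpha_1,\alpha_2$. * Interaction symmetry: if $v(S\cup\{i\})=v(S\cup\{j\})$ for all $S\subseteq[d]\setminus\{i,j\}$, then $\mathcal E_{T\cup\{i\}}(v,\ell)=\mathcal E_{T\cup\{j\}}(v,\ell)$ for all $T\subseteq[d]\setminus\{i,j\}$ with $|T|<\ell$. * Interaction dummy: if $v(S\cup\{i\})=v(S)$ for all $S\subseteq[d]\setminus\{i\}$, then $\mathcal E_T(v,\ell)=0$ for all $T$ with $i\in T$, $|T|\le\ell$. * Interaction efficiency: $\sum_{1\le|S|\le\ell}\mathcal E_S(v,\ell)=v([d])-v(\emptyset)$ and $\mathcal E_\emptyset(v,\ell)=v(\emptyset)$ for all $v$. Then exactly one Faith-Interaction index satisfies all four axioms. Denote it by $\mathcal E^{\text{F-Shap}}$. It has the following properties. 1. Consider the weightings of the form $$\mu(\emptyset)=\mu([d])=\infty,\qquad \mu(S)=c\,\frac{d-1}{\binom d{|S|}\,|S|\,(d-|S|)}\quad(1\le|S|\le d-1),\qquad c>0.\tag{$*$}$$ Every weighting of this form is proper, and $\mathcal E^{\text{F-Shap}}$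 is the only index given by it. Conversely, if $d\ge2$, every proper weighting that gives $\mathcal E^{\text{F-Shap}}$ is of the form $(*)$. 2. With the Möbius transform $a(v,S)=\sum_{T\subseteq S}(-1)^{|S|-|T|}v(T)$, for all $v$, all $\ell\in[d]$ and all $S$ with $|S|\le\ell$, $$\mathcal E^{\text{F-Shap}}_S(v,\ell)=a(v,S)+(-1)^{\ell-|S|}\frac{|S|}{\ell+|S|}\binom{\ell}{|S|}\sum_{T\supsetneq S,\;|T|>\ell}\frac{\binom{|T|-1}{\ell}}{\binom{|T|+\ell-1}{\ell+|S|}}\,a(v,T).$$ 3. With the discrete derivatives $\Delta_Sv(T)=\sum_{L\subseteq S}(-1)^{|S|-|L|}v(T\cup L)$, for all $v$, all $\ell\in[d]$ and all $S$ with $|S|=\ell$, $$\mathcal E^{\text{F-Shap}}_S(v,\ell)=\frac{(2\ell-1)!}{((\ell-1)!)^2}\sum_{T\subseteq[d]\setminus S}\frac{(\ell+|T|-1)!\,(d-|T|-1)!}{(d+\ell-1)!}\,\Delta_Sv(T),$$ and this is a weighted average: the coefficients of the $\Delta_Sv(T)$ are positive and sum to $1$. -/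

import Mathlib

/-- A set function (coalition game) `v : 2^[d] → ℝ`, with `[d]` modelled by `Fin d`. -/
abbrev SetFunction (d : ℕ) : Type := Finset (Fin d) → ℝ

/-- The maximum interaction orders `ℓ ∈ [d] = {1, …, d}`. -/
abbrev InteractionOrder (d : ℕ) : Type := {l : ℕ // 1 ≤ l ∧ l ≤ d}

/-- The family of all subsets of `[d]` with at most `l` elements. -/
abbrev SmallSubset (d l : ℕ) : Type := {S : Finset (Fin d) // S.card ≤ l}

/-- An interaction index assigns to every set function `v` and every maximum interaction order
`l ∈ [d]` a real number for every `S ⊆ [d]` with `|S| ≤ l`. -/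
abbrev InteractionIndex (d : ℕ) : Type :=
  SetFunction d → (l : InteractionOrder d) → SmallSubset d l.1 → ℝ

/-- The Möbius transform of `v`. -/
def moebiusTransform {d : ℕ} (v : SetFunction d) (S : Finset (Fin d)) : ℝ :=
  ∑ T ∈ S.powerset, (-1 : ℝ) ^ (S.card - T.card) * v T

/-- The discrete derivative `Δ_S v(T)`; it is used for disjoint `S` and `T`. -/
def discreteDerivative {d : ℕ} (v : SetFunction d) (S T : Finset (Fin d)) : ℝ :=
  ∑ L ∈ S.powerset, (-1 : ℝ) ^ (S.card - L.card) * v (T ∪ L)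

theorem discreteDerivative_empty {d : ℕ} (v : SetFunction d) (T : Finset (Fin d)) :
    discreteDerivative v ∅ T = v T := by
  simp [discreteDerivative]

/-- The recursive description of the discrete derivative. -/
theorem discreteDerivative_insert {d : ℕ} (v : SetFunction d) (S T : Finset (Fin d)) (i : Fin d)
    (hi : i ∉ S) :
    discreteDerivative v (insert i S) T =
      discreteDerivative v S (insert i T) - discreteDerivative v S T := by
  unfold discreteDerivative
  rw [Finset.sum_powerset_insert hi, add_comm, sub_eq_add_neg, ← Finset.sum_neg_distrib]
  congr 1
  · refine Finset.sum_congr rfl fun L hL => ?_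
    have hLS := Finset.mem_powerset.1 hL
    have hiL : i ∉ L := fun h => hi (hLS h)
    rw [Finset.card_insert_of_notMem hi, Finset.card_insert_of_notMem hiL,
      Nat.add_sub_add_right, Finset.union_insert, Finset.insert_union]
  · refine Finset.sum_congr rfl fun L hL => ?_
    have hle := Finset.card_le_card (Finset.mem_powerset.1 hL)
    rw [Finset.card_insert_of_notMem hi, Nat.succ_sub hle, pow_succ]
    ring

/-- The value at `S` of the order-`l` polynomial with coefficients `x`:
`∑_{T ⊆ S, |T| ≤ l} x_T`. -/
def polynomialFit {d l : ℕ} (x : SmallSubset d l → ℝ) (S : Finset (Fin d)) : ℝ :=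
  ∑ T : SmallSubset d l, if T.1 ⊆ S then x T else 0

/-- A coalition weighting function `μ : 2^[d] → ℝ⁺ ∪ {∞}` (never zero) is proper if it is finite
at all `S` with `1 ≤ |S| ≤ d - 1`. -/
def IsProperWeighting {d : ℕ} (μ : Finset (Fin d) → ENNReal) : Prop :=
  (∀ S, 0 < μ S) ∧ ∀ S : Finset (Fin d), 1 ≤ S.card → S.card < d → μ S ≠ ⊤

/-- The weighted least-squares objective, over the sets of finite weight. -/
noncomputable def regressionObjective {d l : ℕ} (μ : Finset (Fin d) → ENNReal)
    (v : SetFunction d) (x : SmallSubset d l → ℝ) : ℝ :=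
  ∑ S : Finset (Fin d), open Classical in
    if μ S = ⊤ then 0 else (μ S).toReal * (v S - polynomialFit x S) ^ 2

/-- The constraint set: the fit is exact at all sets of infinite weight. -/
def regressionFeasible {d l : ℕ} (μ : Finset (Fin d) → ENNReal)
    (v : SetFunction d) : Set (SmallSubset d l → ℝ) :=
  {x | ∀ S, μ S = ⊤ → v S = polynomialFit x S}

/-- `x` is a minimizer of the constrained weighted regression problem. -/
def IsRegressionMinimizer {d l : ℕ} (μ : Finset (Fin d) → ENNReal)
    (v : SetFunction d) (x : SmallSubset d l → ℝ) : Prop :=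
  x ∈ regressionFeasible μ v ∧ IsMinOn (regressionObjective μ v) (regressionFeasible μ v) x

/-- `E` is obtained from the weighting function `μ`: for all `v` and all `l`, the vector `E(v, l)`
minimizes the weighted regression problem. -/
def IsFaithfulFor {d : ℕ} (μ : Finset (Fin d) → ENNReal) (E : InteractionIndex d) : Prop :=
  ∀ (v : SetFunction d) (l : InteractionOrder d), IsRegressionMinimizer μ v (E v l)

/-- Faith-Interaction indices. -/
def IsFaithInteractionIndex {d : ℕ} (E : InteractionIndex d) : Prop :=
  ∃ μ : Finset (Fin d) → ENNReal, IsProperWeighting μ ∧ IsFaithfulFor μ E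

/-- Interaction linearity. -/
def InteractionLinearity {d : ℕ} (E : InteractionIndex d) : Prop :=
  ∀ (l : InteractionOrder d) (v₁ v₂ : SetFunction d) (α₁ α₂ : ℝ),
    E (α₁ • v₁ + α₂ • v₂) l = α₁ • E v₁ l + α₂ • E v₂ l

/-- Interaction symmetry. -/
def InteractionSymmetry {d : ℕ} (E : InteractionIndex d) : Prop :=
  ∀ (l : InteractionOrder d) (v : SetFunction d) (i j : Fin d),
    (∀ S : Finset (Fin d), i ∉ S → j ∉ S → v (insert i S) = v (insert j S)) →
    ∀ (T : Finset (Fin d)) (hT : T.card < l.1), i ∉ T → j ∉ T →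
      E v l ⟨insert i T, (Finset.card_insert_le i T).trans hT⟩ =
        E v l ⟨insert j T, (Finset.card_insert_le j T).trans hT⟩

/-- Interaction dummy. -/
def InteractionDummy {d : ℕ} (E : InteractionIndex d) : Prop :=
  ∀ (l : InteractionOrder d) (v : SetFunction d) (i : Fin d),
    (∀ S : Finset (Fin d), i ∉ S → v (insert i S) = v S) →
    ∀ T : SmallSubset d l.1, i ∈ T.1 → E v l T = 0

/-- Interaction efficiency. -/
def InteractionEfficiency {d : ℕ} (E : InteractionIndex d) : Prop :=
  ∀ (l : InteractionOrder d) (v : SetFunction d),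
    (∑ S : SmallSubset d l.1, if S.1 = ∅ then 0 else E v l S) = v Finset.univ - v ∅ ∧
    E v l ⟨∅, Nat.zero_le l.1⟩ = v ∅

/-- The four interaction counterparts of the Shapley axioms. -/
def SatisfiesShapleyAxioms {d : ℕ} (E : InteractionIndex d) : Prop :=
  InteractionLinearity E ∧ InteractionSymmetry E ∧ InteractionDummy E ∧ InteractionEfficiency E

/-- `μ(S) ∝ (d - 1) / (C(d, |S|) |S| (d - |S|))` for `1 ≤ |S| ≤ d - 1`, with a positive constant
of proportionality, and `μ(∅) = μ([d]) = ∞`. -/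
def IsFaithShapWeighting {d : ℕ} (μ : Finset (Fin d) → ENNReal) : Prop :=
  μ ∅ = ⊤ ∧ μ Finset.univ = ⊤ ∧
  ∃ c : ℝ, 0 < c ∧ ∀ S : Finset (Fin d), 1 ≤ S.card → S.card < d →
    μ S = ENNReal.ofReal
      (c * (((d : ℝ) - 1) / ((d.choose S.card : ℝ) * (S.card : ℝ) * ((d : ℝ) - (S.card : ℝ)))))

/-- The weight of `Δ_S v(T)`, `|S| = l`, `|T| = t`, in the top-order terms. -/
noncomputable def topOrderWeight (d l t : ℕ) : ℝ :=
  ((2 * l - 1).factorial : ℝ) / ((l - 1).factorial : ℝ) ^ 2 *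
    (((l + t - 1).factorial : ℝ) * ((d - t - 1).factorial : ℝ) / ((d + l - 1).factorial : ℝ))

/-!
# The Faith-Shap interaction index

Up to a constant factor the Faith-Shap weight of a set `S` with `1 ≤ |S| ≤ d - 1` is the Beta value
`beta |S| (d - |S|) = ∫ x ^ (|S| - 1) (1 - x) ^ (d - |S| - 1) dx`. Such a weighted sum over sets is
therefore an expectation over a random set that contains each player independently with
probability `x`, integrated against `dx / (x (1 - x))`, and players on which a summand does not
depend can be summed out (`sum_powerset_beta`).

*The closed form is given by these weights.* A vector minimizes the regression problem if and only
if it is feasible and satisfies the normal equations (`isRegressionMinimizer_iff`), and it is then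
unique, since a polynomial that vanishes on all sets has zero coefficients. By Möbius inversion the
residual of the closed form is a combination of residuals of unanimity games of sets `R` with
`|R| = t > l` (`sub_polynomialFit_faithShap`), and such a residual depends only on `|S ∩ R|` and
vanishes when `S ∩ R` is `∅` or `R`. Summing out the players outside `R` and `T`, its inner product
with the unanimity game of `T` depends only on `|T ∩ R|` and `|T \ R|`. It is the same number for all
`T` with `1 ≤ |T| ≤ l` (`residualMoment_eq`): for `T` disjoint from `R` this is a partial fraction
identity, which is Lagrange interpolation at the nodes `0, …, l`
(`sum_choose_mul_shapCoeff_div`), and integration by parts carries it over to the other `T`. A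
polynomial that vanishes at `∅` and `univ` has no constant term and coefficients that sum to zero,
so it is orthogonal to the residual.

*The axioms determine the weights.* For maximal order `1` the axioms force the Shapley value on the
games that are nonzero at a single set (`firstOrderValue_diracGame_of_mem`). The residuals of the
games of `∅` and of `univ` show that these two sets have infinite weight. The normal equations of the
games of the remaining sets `R`, tested on the functions `S ↦ [i ∈ S] - |S| / d`, express the weight
of `R` through the Gram matrix of these functions; symmetry of that matrix leaves a single free
constant (`weight_eq`). Hence every Faith-Interaction index that satisfies the axioms has a
Faith-Shap weighting and equals the closed form (`eq_faithShap`); for `d = 1` every fit is exact.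

*Top-order terms.* A discrete derivative `Δ_S v(T)` is the sum of the Möbius transforms at `S ∪ U`
for `U ⊆ T`; summing out the elements of `T \ U` turns the weighted average of discrete derivatives
into the closed form (`faithShap_topOrder`).
-/

namespace FaithShap

open Finset

/-! ### Weighted least squares -/

section Regression

variable {d l : ℕ}

theorem polynomialFit_add (x y : SmallSubset d l → ℝ) (S : Finset (Fin d)) :
    polynomialFit (x + y) S = polynomialFit x S + polynomialFit y S := by
  simp only [polynomialFit, ← sum_add_distrib, Pi.add_apply]
  exact sum_congr rfl fun T _ => by split_ifs <;> simp

theorem polynomialFit_smul (c : ℝ) (x : SmallSubset d l → ℝ) (S : Finset (Fin d)) :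
    polynomialFit (c • x) S = c * polynomialFit x S := by
  simp only [polynomialFit, mul_sum, Pi.smul_apply, smul_eq_mul, mul_ite, mul_zero]

/-- A sum over the subtype of small sets as a sum over all sets. -/
theorem sum_smallSubset (F : Finset (Fin d) → ℝ) :
    ∑ T : SmallSubset d l, F T.1 = ∑ T : Finset (Fin d) with T.card ≤ l, F T :=
  (sum_subtype _ (by simp) F).symm

theorem polynomialFit_empty (x : SmallSubset d l → ℝ) :
    polynomialFit x ∅ = x ⟨∅, Nat.zero_le l⟩ := by
  unfold polynomialFit
  rw [sum_eq_single (⟨∅, Nat.zero_le l⟩ : SmallSubset d l)]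
  · simp
  · intro T _ hT
    rw [if_neg]
    intro h
    exact hT (Subtype.ext (subset_empty.1 h))
  · simp

theorem polynomialFit_univ (x : SmallSubset d l → ℝ) :
    polynomialFit x univ = ∑ T, x T := by
  simp [polynomialFit]

/-- A polynomial that vanishes on every set has vanishing coefficients: on a set `T` with at most
`l` elements the fit is the coefficient at `T` plus coefficients at smaller sets. -/
theorem eq_zero_of_polynomialFit_eq_zero (x : SmallSubset d l → ℝ)
    (h : ∀ S, polynomialFit x S = 0) : x = 0 := by
  have key : ∀ n : ℕ, ∀ T : SmallSubset d l, T.1.card = n → x T = 0 := by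
    intro n
    induction n using Nat.strong_induction_on with
    | _ n ih =>
      intro T hT
      have h1 := h T.1
      unfold polynomialFit at h1
      rw [sum_eq_single T] at h1
      · simpa using h1
      · intro U _ hUT
        split_ifs with hsub
        · refine ih U.1.card ?_ U rfl
          rw [← hT]
          exact card_lt_card (hsub.ssubset_of_ne fun e => hUT (Subtype.ext e))
        · rfl
      · simp
  funext T
  exact key _ T rfl

theorem regressionObjective_eq (μ : Finset (Fin d) → ENNReal) (v : SetFunction d)
    (x : SmallSubset d l → ℝ) :
    regressionObjective μ v x = ∑ S, (μ S).toReal * (v S - polynomialFit x S) ^ 2 := by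
  unfold regressionObjective
  refine sum_congr rfl fun S _ => ?_
  split_ifs with h
  · simp [h]
  · rfl

/-- The normal equations: `x` is feasible, and its residual is orthogonal to every polynomial
that vanishes on the sets of infinite weight. Sets of infinite weight drop out of the sum, since
`(⊤ : ENNReal).toReal = 0`. -/
def SatisfiesNormalEquations (μ : Finset (Fin d) → ENNReal) (v : SetFunction d)
    (x : SmallSubset d l → ℝ) : Prop :=
  x ∈ regressionFeasible μ v ∧
    ∀ y : SmallSubset d l → ℝ, (∀ S, μ S = ⊤ → polynomialFit y S = 0) →
      ∑ S, (μ S).toReal * ((v S - polynomialFit x S) * polynomialFit y S) = 0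

theorem regressionObjective_add_smul (μ : Finset (Fin d) → ENNReal) (v : SetFunction d)
    (x y : SmallSubset d l → ℝ) (c : ℝ) :
    regressionObjective μ v (x + c • y) = regressionObjective μ v x
      - 2 * c * ∑ S, (μ S).toReal * ((v S - polynomialFit x S) * polynomialFit y S)
      + c ^ 2 * ∑ S, (μ S).toReal * polynomialFit y S ^ 2 := by
  simp only [regressionObjective_eq, polynomialFit_add, polynomialFit_smul, mul_sum,
    ← sum_sub_distrib, ← sum_add_distrib]
  exact sum_congr rfl fun S _ => by ring

theorem isRegressionMinimizer_iff (μ : Finset (Fin d) → ENNReal) (v : SetFunction d)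
    (x : SmallSubset d l → ℝ) :
    IsRegressionMinimizer μ v x ↔ SatisfiesNormalEquations μ v x := by
  constructor
  · rintro ⟨hx, hmin⟩
    refine ⟨hx, fun y hy => ?_⟩
    set A := ∑ S, (μ S).toReal * ((v S - polynomialFit x S) * polynomialFit y S) with hA
    set B := ∑ S, (μ S).toReal * polynomialFit y S ^ 2 with hB
    have hB0 : 0 ≤ B := sum_nonneg fun S _ => by positivity
    -- along the line `x + c • y` the objective is a quadratic in `c` with a minimum at `c = 0`
    have hquad : ∀ c : ℝ, 0 ≤ -2 * c * A + c ^ 2 * B := by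
      intro c
      have hfeas : x + c • y ∈ regressionFeasible μ v := by
        intro S hS
        rw [polynomialFit_add, polynomialFit_smul, hy S hS, hx S hS]
        ring
      have := isMinOn_iff.1 hmin _ hfeas
      rw [regressionObjective_add_smul] at this
      linarith
    have h1 := hquad (A / (B + 1))
    have hB1 : 0 < B + 1 := by linarith
    have h2 : -2 * (A / (B + 1)) * A + (A / (B + 1)) ^ 2 * B
        = -(A ^ 2 * (B + 2)) / (B + 1) ^ 2 := by
      field_simp
      ring
    rw [h2, le_div_iff₀ (by positivity)] at h1
    have h3 : A ^ 2 = 0 := by nlinarith [sq_nonneg A]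
    exact pow_eq_zero_iff two_ne_zero |>.1 h3
  · rintro ⟨hx, hne⟩
    refine ⟨hx, isMinOn_iff.2 fun x' hx' => ?_⟩
    have hy : ∀ S, μ S = ⊤ → polynomialFit (x' + (-1 : ℝ) • x) S = 0 := by
      intro S hS
      rw [polynomialFit_add, polynomialFit_smul, ← hx S hS, ← hx' S hS]
      ring
    have hx'eq : x' = x + (1 : ℝ) • (x' + (-1 : ℝ) • x) := by
      simp
    rw [hx'eq, regressionObjective_add_smul, hne _ hy]
    have : 0 ≤ ∑ S, (μ S).toReal * polynomialFit (x' + (-1 : ℝ) • x) S ^ 2 :=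
      sum_nonneg fun S _ => by positivity
    linarith

theorem SatisfiesNormalEquations.unique {μ : Finset (Fin d) → ENNReal} (hμ : ∀ S, 0 < μ S)
    {v : SetFunction d} {x x' : SmallSubset d l → ℝ} (hx : SatisfiesNormalEquations μ v x)
    (hx' : SatisfiesNormalEquations μ v x') : x = x' := by
  set y := x' + (-1 : ℝ) • x with hydef
  have hfit : ∀ S, polynomialFit y S = polynomialFit x' S - polynomialFit x S := by
    intro S
    rw [hydef, polynomialFit_add, polynomialFit_smul]
    ring
  have hy : ∀ S, μ S = ⊤ → polynomialFit y S = 0 := by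
    intro S hS
    rw [hfit, ← hx.1 S hS, ← hx'.1 S hS, sub_self]
  -- subtracting the two normal equations tested on `y = x' - x`
  have hsq : ∑ S, (μ S).toReal * polynomialFit y S ^ 2 = 0 := by
    have h1 := hx.2 y hy
    have h2 := hx'.2 y hy
    rw [← sub_eq_zero.2 (h1.trans h2.symm), ← sum_sub_distrib]
    refine sum_congr rfl fun S _ => ?_
    rw [hfit]
    ring
  have hzero : y = 0 := by
    refine eq_zero_of_polynomialFit_eq_zero y fun S => ?_
    by_cases hS : μ S = ⊤
    · exact hy S hS
    · have h0 := (sum_eq_zero_iff_of_nonneg fun S _ => by positivity).1 hsq S (mem_univ S)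
      have hpos : 0 < (μ S).toReal := ENNReal.toReal_pos (hμ S).ne' hS
      simpa [hpos.ne'] using h0
  funext T
  have := congrFun hzero T
  simp [hydef] at this
  linarith

/-- An index is determined by any positive weighting that gives it. -/
theorem isFaithfulFor_unique {μ : Finset (Fin d) → ENNReal} (hμ : ∀ S, 0 < μ S)
    {E E' : InteractionIndex d} (hE : IsFaithfulFor μ E) (hE' : IsFaithfulFor μ E') : E = E' := by
  funext v l
  exact ((isRegressionMinimizer_iff _ _ _).1 (hE v l)).unique hμ
    ((isRegressionMinimizer_iff _ _ _).1 (hE' v l))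

end Regression

/-! ### Beta weights -/

section Beta

/-- The values `(a - 1)! (b - 1)! / (a + b - 1)!` of the Beta function at positive integers
`a` and `b`; its values at `a = 0` or `b = 0` carry no meaning. -/
noncomputable def beta (a b : ℕ) : ℝ :=
  ((a - 1).factorial : ℝ) * ((b - 1).factorial : ℝ) / ((a + b - 1).factorial : ℝ)

theorem beta_pos (a b : ℕ) : 0 < beta a b := by
  unfold beta
  positivity

theorem beta_one_right {a : ℕ} (ha : 1 ≤ a) : beta a 1 = 1 / a := by
  obtain ⟨a, rfl⟩ := Nat.exists_eq_add_of_le' ha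
  unfold beta
  simp only [Nat.add_sub_cancel, Nat.sub_self, Nat.factorial_zero, Nat.factorial_succ]
  push_cast
  have := Nat.factorial_pos a
  field_simp

theorem add_mul_beta_succ_left {a b : ℕ} (ha : 1 ≤ a) (hb : 1 ≤ b) :
    ((a : ℝ) + b) * beta (a + 1) b = a * beta a b := by
  obtain ⟨a, rfl⟩ := Nat.exists_eq_add_of_le' ha
  obtain ⟨b, rfl⟩ := Nat.exists_eq_add_of_le' hb
  unfold beta
  rw [show a + 1 + 1 - 1 = a + 1 by omega, show a + 1 + 1 + (b + 1) - 1 = (a + b + 1) + 1 by omega,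
    show a + 1 + (b + 1) - 1 = a + b + 1 by omega, Nat.factorial_succ (a + b + 1),
    Nat.add_sub_cancel, Nat.add_sub_cancel, Nat.factorial_succ a]
  push_cast
  field_simp
  ring

theorem beta_comm (a b : ℕ) : beta a b = beta b a := by
  unfold beta
  rw [add_comm a b, mul_comm]

theorem add_mul_beta_succ_right {a b : ℕ} (ha : 1 ≤ a) (hb : 1 ≤ b) :
    ((a : ℝ) + b) * beta a (b + 1) = b * beta a b := by
  rw [beta_comm, beta_comm a b, add_comm, add_mul_beta_succ_left hb ha]

theorem beta_succ_add_beta_succ {a b : ℕ} (ha : 1 ≤ a) (hb : 1 ≤ b) :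
    beta (a + 1) b + beta a (b + 1) = beta a b := by
  have h1 := add_mul_beta_succ_left ha hb
  have h2 := add_mul_beta_succ_right ha hb
  have h : (0 : ℝ) < a + b := by positivity
  refine mul_left_cancel₀ h.ne' ?_
  linarith

/-- Elements outside the support of a summand can be summed out of Beta weights. This is the
discrete form of `∫ x ^ (a - 1) (1 - x) ^ (b - 1) (x + (1 - x)) ^ |N| dx`. -/
theorem sum_powerset_beta {α : Type*} [DecidableEq α] (N : Finset α) :
    ∀ {a b : ℕ}, 1 ≤ a → 1 ≤ b →
      ∑ W ∈ N.powerset, beta (a + W.card) (b + (N.card - W.card)) = beta a b := by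
  induction N using Finset.induction_on with
  | empty => intro a b _ _; simp
  | insert x N hx ih =>
    intro a b ha hb
    rw [sum_powerset_insert hx, card_insert_of_notMem hx, ← beta_succ_add_beta_succ ha hb,
      add_comm, ← ih (show 1 ≤ a + 1 by omega) hb, ← ih ha (show 1 ≤ b + 1 by omega)]
    congr 1 <;> refine sum_congr rfl fun W hW => ?_
    · rw [card_insert_of_notMem fun h => hx (mem_powerset.1 hW h)]
      congr 1 <;> omega
    · have := card_le_card (mem_powerset.1 hW)
      congr 1
      omega

/-- The case of `sum_powerset_beta` in which only cardinalities are recorded. -/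
theorem sum_choose_mul_beta (n : ℕ) {a b : ℕ} (ha : 1 ≤ a) (hb : 1 ≤ b) :
    ∑ i ∈ range (n + 1), (n.choose i : ℝ) * beta (a + i) (b + (n - i)) = beta a b := by
  rw [← sum_powerset_beta (range n) ha hb, card_range,
    sum_powerset_apply_card (fun i => beta (a + i) (b + (n - i))) (x := range n), card_range]
  simp

/-- Choosing a `k`-subset of a `j`-subset amounts to choosing the `k`-subset first. -/
theorem sum_choose_mul_choose {t k : ℕ} (hk : k ≤ t) (f : ℕ → ℝ) :
    ∑ j ∈ range (t + 1), (t.choose j : ℝ) * j.choose k * f j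
      = t.choose k * ∑ i ∈ range (t - k + 1), ((t - k).choose i : ℝ) * f (k + i) := by
  rw [show t + 1 = k + (t - k + 1) by omega, sum_range_add, mul_sum]
  rw [sum_eq_zero fun j hj => ?_, zero_add]
  · refine sum_congr rfl fun i hi => ?_
    have h := Nat.choose_mul (n := t) (k := k + i) (s := k) (by omega)
    rw [show k + i - k = i by omega] at h
    rw [← mul_assoc, ← Nat.cast_mul, h, Nat.cast_mul]
  · rw [Nat.choose_eq_zero_of_lt (mem_range.1 hj)]
    simp

theorem sum_choose_mul_choose_mul_beta {t k a b : ℕ} (hk : k ≤ t) (ha : 1 ≤ a + k) (hb : 1 ≤ b) :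
    ∑ j ∈ range (t + 1), (t.choose j : ℝ) * j.choose k * beta (a + j) (b + (t - j))
      = t.choose k * beta (a + k) b := by
  rw [sum_choose_mul_choose hk fun j => beta (a + j) (b + (t - j)),
    ← sum_choose_mul_beta (t - k) ha hb]
  congr 1
  refine sum_congr rfl fun i hi => ?_
  rw [show a + (k + i) = a + k + i by omega, show t - (k + i) = t - k - i by omega]

end Beta

/-! ### The coefficients of the closed form -/

section Coefficients

/-- The coefficient of the Möbius transform at a set of size `t > l` in the closed form at a set
of size `s`. -/
noncomputable def shapCoeff (l t s : ℕ) : ℝ :=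
  (-1 : ℝ) ^ (l - s) * ((s : ℝ) / ((l : ℝ) + s)) * (l.choose s : ℝ) *
    (((t - 1).choose l : ℝ) / ((t + l - 1).choose (l + s) : ℝ))

theorem shapCoeff_zero (l t : ℕ) : shapCoeff l t 0 = 0 := by
  simp [shapCoeff]

theorem prod_range_erase_sub {l s : ℕ} (hs : s ≤ l) :
    ∏ j ∈ (range (l + 1)).erase s, ((s : ℝ) - j)
      = (s.factorial : ℝ) * ((-1) ^ (l - s) * ((l - s).factorial : ℝ)) := by
  have hset : (range (l + 1)).erase s = range s ∪ Ico (s + 1) (l + 1) := by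
    ext j
    simp only [mem_erase, mem_range, mem_union, mem_Ico]
    omega
  have hdisj : Disjoint (range s) (Ico (s + 1) (l + 1)) := by
    rw [disjoint_left]
    intro j
    simp only [mem_range, mem_Ico]
    omega
  rw [hset, prod_union hdisj]
  congr 1
  · rw [← prod_range_add_one_eq_factorial, ← prod_range_reflect, Nat.cast_prod]
    refine prod_congr rfl fun j hj => ?_
    have hj := mem_range.1 hj
    rw [Nat.sub_sub, Nat.cast_sub (by omega)]
    push_cast
    ring
  · rw [prod_Ico_eq_prod_range, ← prod_range_add_one_eq_factorial, Nat.cast_prod,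
      show l + 1 - (s + 1) = l - s by omega]
    nth_rewrite 2 [← card_range (l - s)]
    rw [← prod_const, ← prod_mul_distrib]
    refine prod_congr rfl fun j hj => ?_
    push_cast
    ring

theorem prod_range_sub_eq {l t : ℕ} (ht : l < t) :
    ∏ j ∈ range (l + 1), ((t : ℝ) - j) = (t.factorial : ℝ) / ((t - l - 1).factorial : ℝ) := by
  rw [eq_div_iff (by positivity)]
  have h := Nat.factorial_mul_descFactorial (show l + 1 ≤ t from ht)
  rw [Nat.descFactorial_eq_prod_range] at h
  rw [← h, mul_comm, Nat.sub_sub]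
  push_cast
  congr 1
  refine prod_congr rfl fun j hj => ?_
  rw [Nat.cast_sub (by have := mem_range.1 hj; omega)]

/-- Lagrange interpolation at the nodes `0, …, l`, evaluated at `t > l`. -/
theorem sum_neg_one_pow_mul_eval_div {l t : ℕ} (ht : l < t) (Q : Polynomial ℝ)
    (hQ : Q.natDegree ≤ l) :
    ∑ s ∈ range (l + 1), (-1 : ℝ) ^ (l - s) * (l.choose s : ℝ) * (Q.eval (s : ℝ) / ((t : ℝ) - s))
      = (l.factorial : ℝ) * ((t - l - 1).factorial : ℝ) / (t.factorial : ℝ) * Q.eval (t : ℝ) := by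
  have hdeg : Q.degree < ((range (l + 1)).card : ℕ) := by
    rw [card_range]
    exact Polynomial.degree_le_natDegree.trans_lt (by exact_mod_cast Nat.lt_succ_of_le hQ)
  have hinj : Set.InjOn (fun n : ℕ => (n : ℝ)) (range (l + 1) : Finset ℕ) :=
    fun _ _ _ _ h => Nat.cast_injective h
  have hnode : ∀ i ∈ range (l + 1), (t : ℝ) ≠ (fun n : ℕ => (n : ℝ)) i := by
    intro i hi h
    have h : t = i := Nat.cast_injective h
    have := mem_range.1 hi
    omega
  have key := Lagrange.eval_interpolate_not_at_node
    (fun i : ℕ => Q.eval ((fun n : ℕ => (n : ℝ)) i)) hnode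
  rw [← Lagrange.eq_interpolate hinj hdeg, Lagrange.eval_nodal, prod_range_sub_eq ht] at key
  rw [key, ← mul_assoc, mul_sum]
  refine sum_congr rfl fun s hs => ?_
  have hs : s ≤ l := Nat.lt_succ_iff.1 (mem_range.1 hs)
  have hts : (t : ℝ) - s ≠ 0 := by
    have : (s : ℝ) < t := by exact_mod_cast (lt_of_le_of_lt hs ht)
    linarith
  rw [Lagrange.nodalWeight, prod_inv_distrib, prod_range_erase_sub hs, Nat.cast_choose ℝ hs]
  have h1 : ((-1 : ℝ) ^ (l - s)) * (-1) ^ (l - s) = 1 := by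
    rw [← mul_pow]; simp
  have h2 : ((-1 : ℝ) ^ (l - s))⁻¹ = (-1) ^ (l - s) := inv_eq_of_mul_eq_one_left h1
  simp only [mul_inv, h2]
  field_simp

/-- The quotient `(s + l - 1)! / s!` is a polynomial in `s` of degree `l - 1`. -/
theorem factorial_mul_prod_Ico (s : ℕ) {l : ℕ} (hl : 1 ≤ l) :
    (s.factorial : ℝ) * ∏ i ∈ Ico 1 l, ((s : ℝ) + i) = ((s + l - 1).factorial : ℝ) := by
  induction l, hl using Nat.le_induction with
  | base => simp
  | succ n hn ih =>
    rw [prod_Ico_succ_top hn, ← mul_assoc, ih, show s + (n + 1) - 1 = (s + n - 1) + 1 by omega,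
      Nat.factorial_succ, show s + n - 1 + 1 = s + n by omega]
    push_cast
    ring

/-- Up to a factor that depends only on `l` and `t`, the number `t.choose s * shapCoeff l t s` is the
term at the node `s` of a Lagrange interpolation formula with nodes `0, …, l`, for a polynomial of
degree `l`. -/
theorem choose_mul_shapCoeff {l t s : ℕ} (hl : 1 ≤ l) (ht : l < t) (hs : s ≤ l) :
    (t.choose s : ℝ) * shapCoeff l t s
      = ((t - 1).choose l : ℝ) * (t.factorial : ℝ) / ((t + l - 1).factorial : ℝ) *
        ((-1 : ℝ) ^ (l - s) * (l.choose s : ℝ) *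
          ((s * ∏ i ∈ Ico 1 l, ((s : ℝ) + i)) / ((t : ℝ) - s))) := by
  have hprod : ∏ i ∈ Ico 1 l, ((s : ℝ) + i) = ((s + l - 1).factorial : ℝ) / s.factorial := by
    rw [← factorial_mul_prod_Ico s hl]
    field_simp
  obtain ⟨n, rfl⟩ : ∃ n, t = s + (n + 1) := ⟨t - s - 1, by omega⟩
  obtain ⟨m, rfl⟩ : ∃ m, l = m + 1 := ⟨l - 1, by omega⟩
  rw [hprod, shapCoeff, Nat.cast_choose ℝ (show s ≤ s + (n + 1) by omega),
    Nat.cast_choose ℝ (show m + 1 + s ≤ s + (n + 1) + (m + 1) - 1 by omega),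
    show s + (n + 1) - s = n + 1 by omega,
    show s + (n + 1) + (m + 1) - 1 - (m + 1 + s) = n by omega,
    show s + (m + 1) - 1 = s + m by omega, show m + 1 + s = (s + m) + 1 by omega,
    Nat.factorial_succ n, Nat.factorial_succ (s + m)]
  push_cast
  have h1 : (m : ℝ) + 1 + s ≠ 0 := by positivity
  have h2 : (s : ℝ) + m + 1 ≠ 0 := by positivity
  have h3 : (s : ℝ) + (n + 1) - s ≠ 0 := by
    have : (s : ℝ) + (n + 1) - s = n + 1 := by ring
    rw [this]; positivity
  field_simp
  ring

/-- The value at `t` of the interpolated polynomial is the reciprocal of the factor in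
`choose_mul_shapCoeff`. -/
theorem interpolation_normalization {l t : ℕ} (hl : 1 ≤ l) (ht : l < t) :
    ((t - 1).choose l : ℝ) * (t.factorial : ℝ) / ((t + l - 1).factorial : ℝ) *
      ((l.factorial : ℝ) * ((t - l - 1).factorial : ℝ) / (t.factorial : ℝ) *
        (t * ∏ i ∈ Ico 1 l, ((t : ℝ) + i))) = 1 := by
  have hprod : ∏ i ∈ Ico 1 l, ((t : ℝ) + i) = ((t + l - 1).factorial : ℝ) / t.factorial := by
    rw [← factorial_mul_prod_Ico t hl]
    field_simp
  rw [hprod, Nat.cast_choose ℝ (show l ≤ t - 1 by omega), show t - 1 - l = t - l - 1 by omega]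
  obtain ⟨n, rfl⟩ : ∃ n, t = n + 1 := ⟨t - 1, by omega⟩
  rw [Nat.factorial_succ n]
  push_cast
  field_simp

/-- Efficiency for unanimity games: the coefficients below a set of size `t` sum to `1`. -/
theorem sum_choose_mul_shapCoeff {l t : ℕ} (hl : 1 ≤ l) (ht : l < t) :
    ∑ s ∈ range (l + 1), (t.choose s : ℝ) * shapCoeff l t s = 1 := by
  set Q : Polynomial ℝ := Polynomial.X * ∏ i ∈ Ico 1 l, (Polynomial.X + Polynomial.C (i : ℝ))
  have hQ : Q.natDegree ≤ l := by
    refine Polynomial.natDegree_mul_le.trans ?_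
    refine (add_le_add Polynomial.natDegree_X_le (Polynomial.natDegree_prod_le _ _)).trans ?_
    simp only [Polynomial.natDegree_X_add_C, sum_const, Nat.card_Ico, smul_eq_mul]
    omega
  have hev : ∀ x : ℝ, Q.eval x = x * ∏ i ∈ Ico 1 l, (x + i) := by
    intro x
    simp [Q, Polynomial.eval_prod]
  have key := sum_neg_one_pow_mul_eval_div ht Q hQ
  simp only [hev] at key
  rw [← interpolation_normalization hl ht, ← key, mul_sum]
  refine sum_congr rfl fun s hs => ?_
  exact choose_mul_shapCoeff hl ht (Nat.lt_succ_iff.1 (mem_range.1 hs))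

/-- Dividing by `m + s` removes one factor of the interpolated polynomial, so that interpolation
stays exact. -/
theorem sum_choose_mul_shapCoeff_div {l t m : ℕ} (ht : l < t) (hm : 1 ≤ m) (hml : m < l) :
    ∑ s ∈ range (l + 1), (t.choose s : ℝ) * shapCoeff l t s / ((m : ℝ) + s) = 1 / ((m : ℝ) + t) := by
  have hl : 1 ≤ l := by omega
  have hmem : m ∈ Ico 1 l := mem_Ico.2 ⟨hm, hml⟩
  set Q : Polynomial ℝ :=
    Polynomial.X * ∏ i ∈ (Ico 1 l).erase m, (Polynomial.X + Polynomial.C (i : ℝ))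
  have hQ : Q.natDegree ≤ l := by
    refine Polynomial.natDegree_mul_le.trans ?_
    refine (add_le_add Polynomial.natDegree_X_le (Polynomial.natDegree_prod_le _ _)).trans ?_
    simp only [Polynomial.natDegree_X_add_C, sum_const, card_erase_of_mem hmem, Nat.card_Ico,
      smul_eq_mul]
    omega
  have hev : ∀ x : ℕ, Q.eval (x : ℝ) = (x * ∏ i ∈ Ico 1 l, ((x : ℝ) + i)) / ((m : ℝ) + x) := by
    intro x
    have hx : (m : ℝ) + x ≠ 0 := by positivity
    rw [← mul_prod_erase _ _ hmem, eq_div_iff hx]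
    simp only [Q, Polynomial.eval_mul, Polynomial.eval_X, Polynomial.eval_prod, Polynomial.eval_add,
      Polynomial.eval_C]
    ring
  have key := sum_neg_one_pow_mul_eval_div ht Q hQ
  simp only [hev] at key
  have haux := interpolation_normalization hl ht
  rw [← haux, mul_div_assoc, mul_div_assoc _ _ ((m : ℝ) + t), ← key, mul_sum]
  refine sum_congr rfl fun s hs => ?_
  rw [choose_mul_shapCoeff hl ht (Nat.lt_succ_iff.1 (mem_range.1 hs))]
  ring

end Coefficients

/-! ### Moments of the residual of a unanimity game -/

section Moments

/-- The residual, at a set that meets `R` in `j` elements, of the closed form for the unanimity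
game of a set `R` with `|R| = t > l`. -/
noncomputable def shapResidual (l t j : ℕ) : ℝ :=
  (if j = t then 1 else 0) - ∑ s ∈ range (l + 1), (j.choose s : ℝ) * shapCoeff l t s

theorem shapResidual_zero {l t : ℕ} (ht : l < t) : shapResidual l t 0 = 0 := by
  unfold shapResidual
  rw [if_neg (by omega), zero_sub, neg_eq_zero]
  refine sum_eq_zero fun s _ => ?_
  rcases Nat.eq_zero_or_pos s with rfl | hs
  · rw [shapCoeff_zero, mul_zero]
  · rw [Nat.choose_eq_zero_of_lt hs, Nat.cast_zero, zero_mul]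

theorem shapResidual_self {l t : ℕ} (hl : 1 ≤ l) (ht : l < t) : shapResidual l t t = 0 := by
  unfold shapResidual
  rw [if_pos rfl, sum_choose_mul_shapCoeff hl ht, sub_self]

/-- The inner product of the residual of the unanimity game of `R`, `|R| = t`, with the unanimity game
of a set `T` such that `|T ∩ R| = k` and `|T \ R| = m`, for the weights `beta |S| (d - |S|)`, times
`t.choose k`; see `sum_beta_mul_shapResidual`. The factor makes the sum over `j` free of side
conditions. -/
noncomputable def residualMoment (l t m k : ℕ) : ℝ :=
  ∑ j ∈ range (t + 1), (t.choose j : ℝ) * j.choose k * (shapResidual l t j * beta (m + j) (t - j))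

/-- In integral form the left side is `∫ x ^ (m - 1) h(x) dx`, where `h(x)` is the expected residual
at a random set that contains each player independently with probability `x`. -/
theorem residualMoment_zero_sub_succ {l t m : ℕ} (hl : 1 ≤ l) (ht : l < t) (hm : 1 ≤ m) :
    residualMoment l t m 0 - residualMoment l t (m + 1) 0
      = 1 / ((m : ℝ) + t) -
        ∑ s ∈ range (l + 1), (t.choose s : ℝ) * shapCoeff l t s / ((m : ℝ) + s) := by
  have h1 : residualMoment l t m 0 - residualMoment l t (m + 1) 0
      = ∑ j ∈ range (t + 1), (t.choose j : ℝ) * shapResidual l t j * beta (m + j) (1 + (t - j)) := by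
    unfold residualMoment
    rw [← sum_sub_distrib]
    refine sum_congr rfl fun j hj => ?_
    rcases (Nat.lt_succ_iff.1 (mem_range.1 hj)).eq_or_lt with rfl | hjt
    · rw [shapResidual_self hl ht]
      simp
    · rw [Nat.choose_zero_right, Nat.cast_one, mul_one,
        ← beta_succ_add_beta_succ (show 1 ≤ m + j by omega) (show 1 ≤ t - j by omega),
        show m + 1 + j = m + j + 1 by omega, add_comm 1 (t - j)]
      ring
  have hone : ∀ s ∈ range (l + 1),
      ∑ j ∈ range (t + 1), (t.choose j : ℝ) * j.choose s * beta (m + j) (1 + (t - j))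
        = t.choose s / ((m : ℝ) + s) := by
    intro s hs
    have hs := mem_range.1 hs
    rw [sum_choose_mul_choose_mul_beta (by omega) (by omega) le_rfl, beta_one_right (by omega)]
    push_cast
    ring
  rw [h1]
  unfold shapResidual
  simp only [mul_sub, sub_mul, sum_sub_distrib]
  congr 1
  · rw [sum_eq_single t]
    · rw [if_pos rfl, Nat.choose_self, Nat.sub_self, beta_one_right (by omega)]
      push_cast
      ring
    · intro j _ hj
      rw [if_neg hj]
      ring
    · intro h
      exact absurd (mem_range.2 (Nat.lt_succ_self t)) h
  · simp only [mul_sum, sum_mul]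
    rw [sum_comm]
    refine sum_congr rfl fun s hs => ?_
    rw [mul_div_right_comm, ← hone s hs, sum_mul]
    exact sum_congr rfl fun j _ => by ring

/-- The discrete form of an integration by parts; it holds term by term, since
`(k + 1) * j.choose (k + 1) = (j - k) * j.choose k` and
`(m + t) * beta (m + j + 1) (t - j) = (m + j) * beta (m + j) (t - j)`. -/
theorem succ_mul_residualMoment_succ {l t m k : ℕ} (hl : 1 ≤ l) (ht : l < t) :
    ((k : ℝ) + 1) * residualMoment l t m (k + 1)
      = ((m : ℝ) + t) * residualMoment l t (m + 1) k - ((m : ℝ) + k) * residualMoment l t m k := by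
  unfold residualMoment
  rw [mul_sum, mul_sum, mul_sum, ← sum_sub_distrib]
  refine sum_congr rfl fun j hj => ?_
  have hjt := Nat.lt_succ_iff.1 (mem_range.1 hj)
  rcases Nat.eq_zero_or_pos j with rfl | hj0
  · rw [shapResidual_zero ht]
    ring
  rcases hjt.eq_or_lt with rfl | hjt
  · rw [shapResidual_self hl ht]
    ring
  have hbeta := add_mul_beta_succ_left (show 1 ≤ m + j by omega) (show 1 ≤ t - j by omega)
  have hchoose : ((k : ℝ) + 1) * j.choose (k + 1) = ((j : ℝ) - k) * j.choose k := by
    rcases le_or_gt k j with hkj | hkj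
    · have := Nat.choose_succ_right_eq j k
      have h2 : ((j.choose (k + 1) * (k + 1) : ℕ) : ℝ) = ((j.choose k * (j - k) : ℕ) : ℝ) := by
        rw [this]
      push_cast [Nat.cast_sub hkj] at h2
      linarith
    · rw [Nat.choose_eq_zero_of_lt hkj, Nat.choose_eq_zero_of_lt (by omega)]
      simp
  rw [show m + 1 + j = m + j + 1 by omega]
  have hcast : ((m + j : ℕ) : ℝ) + ((t - j : ℕ) : ℝ) = (m : ℝ) + t := by
    rw [Nat.cast_sub hjt.le]; push_cast; ring
  rw [hcast] at hbeta
  push_cast at hbeta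
  linear_combination (t.choose j : ℝ) * (shapResidual l t j * beta (m + j) (t - j)) * hchoose
    - (t.choose j : ℝ) * j.choose k * shapResidual l t j * hbeta

/-- The residual has the same inner product with all unanimity games of sets of sizes
`1, …, l`. -/
theorem residualMoment_eq {l t : ℕ} (hl : 1 ≤ l) (ht : l < t) :
    ∀ k m : ℕ, 1 ≤ m + k → m + k ≤ l →
      residualMoment l t m k = t.choose k * residualMoment l t 1 0 := by
  have hstep : ∀ m, 1 ≤ m → m < l → residualMoment l t (m + 1) 0 = residualMoment l t m 0 := by
    intro m hm hml
    have h := residualMoment_zero_sub_succ hl ht hm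
    rw [sum_choose_mul_shapCoeff_div ht hm hml] at h
    linarith
  intro k
  induction k with
  | zero =>
    intro m hm hml
    rw [Nat.choose_zero_right, Nat.cast_one, one_mul]
    induction m, hm using Nat.le_induction with
    | base => rfl
    | succ n hn ih => rw [hstep n hn (by omega), ih (by omega)]
  | succ k ih =>
    intro m hm hml
    have h1 := succ_mul_residualMoment_succ (m := m) (k := k) hl ht
    rw [ih (m + 1) (by omega) (by omega)] at h1
    have hk : k ≤ t := by omega
    have hchoose : ((k : ℝ) + 1) * t.choose (k + 1) = ((t : ℝ) - k) * t.choose k := by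
      have h2 : ((t.choose (k + 1) * (k + 1) : ℕ) : ℝ) = ((t.choose k * (t - k) : ℕ) : ℝ) := by
        rw [Nat.choose_succ_right_eq t k]
      push_cast [Nat.cast_sub hk] at h2
      linarith
    -- at `m = k = 0` the moment `residualMoment l t m k` is not covered, but its factor vanishes
    have h3 : ((m : ℝ) + k) * residualMoment l t m k
        = ((m : ℝ) + k) * (t.choose k * residualMoment l t 1 0) := by
      rcases Nat.eq_zero_or_pos (m + k) with h0 | h0
      · have : (m : ℝ) + k = 0 := by exact_mod_cast h0
        rw [this, zero_mul, zero_mul]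
      · rw [ih m h0 (by omega)]
    rw [h3] at h1
    have hpos : (0 : ℝ) < (k : ℝ) + 1 := by positivity
    refine mul_left_cancel₀ hpos.ne' ?_
    linear_combination h1 - residualMoment l t 1 0 * hchoose

end Moments

/-! ### Set sums against Beta weights -/

section SetSums

variable {d : ℕ}

theorem card_lt_of_ne_univ {S : Finset (Fin d)} (hS : S ≠ univ) : S.card < d := by
  simpa using card_lt_card (ssubset_univ_iff.2 hS)

theorem sum_superset {α : Type*} [DecidableEq α] {A B : Finset α} (h : A ⊆ B)
    (F : Finset α → ℝ) :
    ∑ S ∈ B.powerset with A ⊆ S, F S = ∑ W ∈ (B \ A).powerset, F (A ∪ W) := by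
  have : (B.powerset.filter fun S => A ⊆ S) = Icc A B := by
    ext S
    simp [and_comm]
  rw [this, Icc_eq_image_powerset h, sum_image]
  intro W hW W' hW' he
  have h1 : Disjoint A W := disjoint_of_subset_right (mem_powerset.1 hW) disjoint_sdiff
  have h2 : Disjoint A W' := disjoint_of_subset_right (mem_powerset.1 hW') disjoint_sdiff
  have he : A ∪ W = A ∪ W' := he
  rw [← union_sdiff_cancel_left h1, he, union_sdiff_cancel_left h2]

theorem sum_finset_eq_sum_inter_sdiff (R : Finset (Fin d)) (F : Finset (Fin d) → ℝ) :
    ∑ S, F S = ∑ J ∈ R.powerset, ∑ U ∈ (Rᶜ).powerset, F (J ∪ U) := by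
  rw [← sum_product']
  refine sum_nbij' (fun S => (S ∩ R, S ∩ Rᶜ)) (fun p => p.1 ∪ p.2) ?_ ?_ ?_ ?_ ?_
  · intro S _
    simp [inter_subset_right]
  · simp
  · intro S _
    simp [← inter_union_distrib_left]
  · rintro ⟨J, U⟩ h
    simp only [mem_product, mem_powerset] at h
    obtain ⟨hJ, hU⟩ := h
    have hJU : J ∩ Rᶜ = ∅ := by
      rw [← sdiff_eq_inter_compl]
      exact sdiff_eq_empty_iff_subset.2 hJ
    have hUR : U ∩ R = ∅ := disjoint_iff_inter_eq_empty.1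
      (disjoint_of_subset_left hU disjoint_compl_left)
    simp [union_inter_distrib_right, inter_eq_left.2 hJ, inter_eq_left.2 hU, hJU, hUR]
  · intro S _
    simp [← inter_union_distrib_left]

/-- The sum over the sets between `A` and `B` of a function of the cardinality, scaled by the number
of subsets of `B` of the size of `A`. -/
theorem sum_powerset_superset_card {α : Type*} [DecidableEq α] {A B : Finset α} (h : A ⊆ B)
    (f : ℕ → ℝ) :
    (B.card.choose A.card : ℝ) * ∑ J ∈ B.powerset with A ⊆ J, f J.card
      = ∑ j ∈ range (B.card + 1), (B.card.choose j : ℝ) * j.choose A.card * f j := by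
  rw [sum_choose_mul_choose (card_le_card h), sum_superset h]
  congr 1
  have hc : ∀ W ∈ (B \ A).powerset, f (A ∪ W).card = f (A.card + W.card) := by
    intro W hW
    rw [card_union_of_disjoint (disjoint_of_subset_right (mem_powerset.1 hW) disjoint_sdiff)]
  rw [sum_congr rfl hc, sum_powerset_apply_card (fun i => f (A.card + i)), card_sdiff_of_subset h]
  simp

/-- The inner product of the residual of the unanimity game of `R` with the unanimity game of `T`,
with the elements outside `R` and `T` summed out. -/
theorem sum_beta_mul_shapResidual {l : ℕ} (hl : 1 ≤ l) (R T : Finset (Fin d)) (hR : l < R.card) :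
    (R.card.choose (T ∩ R).card : ℝ) *
      ∑ S : Finset (Fin d) with T ⊆ S,
        beta S.card (d - S.card) * shapResidual l R.card (S ∩ R).card
      = residualMoment l R.card (T \ R).card (T ∩ R).card := by
  rw [residualMoment, ← sum_powerset_superset_card (inter_subset_right : T ∩ R ⊆ R)
    (fun j => shapResidual l R.card j * beta ((T \ R).card + j) (R.card - j))]
  congr 1
  rw [sum_filter, sum_finset_eq_sum_inter_sdiff R, sum_filter]
  refine sum_congr rfl fun J hJ => ?_
  have hJ := mem_powerset.1 hJ
  have hinter : ∀ U ∈ (Rᶜ).powerset, (J ∪ U) ∩ R = J := by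
    intro U hU
    have hUR : U ∩ R = ∅ := disjoint_iff_inter_eq_empty.1
      (disjoint_of_subset_left (mem_powerset.1 hU) disjoint_compl_left)
    rw [union_inter_distrib_right, hUR, union_empty, inter_eq_left.2 hJ]
  -- the residual vanishes unless `J` is a nonempty proper subset of `R`
  by_cases hg : shapResidual l R.card J.card = 0
  · rw [hg, zero_mul, ite_self]
    refine sum_eq_zero fun U hU => ?_
    rw [hinter U hU, hg, mul_zero, ite_self]
  have hJ0 : 1 ≤ J.card := by
    rw [Nat.one_le_iff_ne_zero]
    intro h
    exact hg (by rw [h, shapResidual_zero hR])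
  have hJR : J.card < R.card := by
    refine (card_le_card hJ).lt_of_ne fun h => hg (by rw [h, shapResidual_self hl hR])
  have hsub : ∀ U ∈ (Rᶜ).powerset, (T ⊆ J ∪ U ↔ T ∩ R ⊆ J ∧ T \ R ⊆ U) := by
    intro U hU
    have hU := mem_powerset.1 hU
    constructor
    · intro h
      constructor
      · intro x hx
        rw [mem_inter] at hx
        rcases mem_union.1 (h hx.1) with h | h
        · exact h
        · exact absurd hx.2 (mem_compl.1 (hU h))
      · intro x hx
        rw [mem_sdiff] at hx
        rcases mem_union.1 (h hx.1) with h | h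
        · exact absurd (hJ h) hx.2
        · exact h
    · rintro ⟨h1, h2⟩ x hx
      by_cases hxR : x ∈ R
      · exact mem_union_left _ (h1 (mem_inter.2 ⟨hx, hxR⟩))
      · exact mem_union_right _ (h2 (mem_sdiff.2 ⟨hx, hxR⟩))
  split_ifs with hTJ
  · have hTR : T \ R ⊆ Rᶜ := fun x hx => mem_compl.2 (mem_sdiff.1 hx).2
    have hcardTR := card_le_card hTR
    have hRd : R.card ≤ d := by simpa using card_le_univ R
    rw [card_compl, Fintype.card_fin] at hcardTR
    rw [← sum_powerset_beta (Rᶜ \ (T \ R)) (show 1 ≤ (T \ R).card + J.card by omega)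
      (show 1 ≤ R.card - J.card by omega), mul_sum]
    have hcongr : ∀ U ∈ (Rᶜ).powerset,
        (if T ⊆ J ∪ U then beta (J ∪ U).card (d - (J ∪ U).card) *
          shapResidual l R.card ((J ∪ U) ∩ R).card else 0)
        = if T \ R ⊆ U then shapResidual l R.card J.card *
          beta (J.card + U.card) (d - (J.card + U.card)) else 0 := by
      intro U hU
      have hdisj : Disjoint J U := disjoint_of_subset_left hJ
        (disjoint_of_subset_right (mem_powerset.1 hU) disjoint_compl_right)
      rw [hinter U hU, card_union_of_disjoint hdisj, mul_comm]
      simp only [hsub U hU, hTJ, true_and]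
    rw [sum_congr rfl hcongr, ← sum_filter, sum_superset hTR]
    refine sum_congr rfl fun W hW => ?_
    have hW := mem_powerset.1 hW
    have hcard := card_sdiff_of_subset hTR
    have hWcard := card_le_card hW
    rw [card_compl, Fintype.card_fin] at hcard
    rw [card_union_of_disjoint (disjoint_of_subset_right hW disjoint_sdiff)]
    congr 2 <;> omega
  · refine sum_eq_zero fun U hU => ?_
    rw [if_neg fun h => hTJ ((hsub U hU).1 h).1]

end SetSums

/-! ### The Möbius transform and discrete derivatives -/

section Moebius

variable {d : ℕ}

theorem discreteDerivative_eq_moebiusTransform (v : SetFunction d) (S : Finset (Fin d)) :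
    discreteDerivative v S ∅ = moebiusTransform v S := by
  simp [discreteDerivative, moebiusTransform]

/-- The Taylor expansion of a discrete derivative; `S = ∅` is Möbius inversion. -/
theorem discreteDerivative_eq_sum_moebiusTransform (v : SetFunction d) (T : Finset (Fin d)) :
    ∀ S : Finset (Fin d), Disjoint S T →
      discreteDerivative v S T = ∑ U ∈ T.powerset, moebiusTransform v (S ∪ U) := by
  induction T using Finset.induction_on with
  | empty => intro S _; simp [discreteDerivative_eq_moebiusTransform]
  | insert i T hi ih =>
    intro S hS
    rw [disjoint_insert_right] at hS
    have hins : Disjoint (insert i S) T := disjoint_insert_left.2 ⟨hi, hS.2⟩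
    have h := discreteDerivative_insert v S T i hS.1
    rw [ih _ hins, ih _ hS.2] at h
    rw [sum_powerset_insert hi]
    simp only [union_insert, insert_union] at h ⊢
    linarith

theorem sum_moebiusTransform (v : SetFunction d) (S : Finset (Fin d)) :
    ∑ T ∈ S.powerset, moebiusTransform v T = v S := by
  have h := discreteDerivative_eq_sum_moebiusTransform v S ∅ (disjoint_empty_left S)
  rw [discreteDerivative_empty] at h
  simpa using h.symm

theorem moebiusTransform_linear (v₁ v₂ : SetFunction d) (α₁ α₂ : ℝ) (S : Finset (Fin d)) :
    moebiusTransform (α₁ • v₁ + α₂ • v₂) S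
      = α₁ * moebiusTransform v₁ S + α₂ * moebiusTransform v₂ S := by
  simp only [moebiusTransform, mul_sum, ← sum_add_distrib, Pi.add_apply, Pi.smul_apply, smul_eq_mul]
  exact sum_congr rfl fun T _ => by ring

theorem moebiusTransform_eq_zero_of_dummy {v : SetFunction d} {i : Fin d}
    (hv : ∀ S : Finset (Fin d), i ∉ S → v (insert i S) = v S) {T : Finset (Fin d)} (hi : i ∈ T) :
    moebiusTransform v T = 0 := by
  rw [← discreteDerivative_eq_moebiusTransform, ← insert_erase hi,
    discreteDerivative_insert _ _ _ _ (notMem_erase i T), sub_eq_zero]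
  unfold discreteDerivative
  refine sum_congr rfl fun L hL => ?_
  have hiL : i ∉ L := fun h => notMem_erase i T (mem_powerset.1 hL h)
  rw [insert_union, empty_union, hv L hiL]

theorem moebiusTransform_map {v : SetFunction d} (σ : Equiv.Perm (Fin d))
    (hv : ∀ S, v (S.map σ.toEmbedding) = v S) (T : Finset (Fin d)) :
    moebiusTransform v (T.map σ.toEmbedding) = moebiusTransform v T := by
  unfold moebiusTransform
  refine (sum_equiv σ.finsetCongr (fun S => ?_) fun S _ => ?_).symm
  · simp
  · simp [hv]

theorem map_swap_eq_self {i j : Fin d} {S : Finset (Fin d)} (hij : i ∈ S ↔ j ∈ S) :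
    S.map (Equiv.swap i j).toEmbedding = S := by
  ext x
  rw [mem_map_equiv, Equiv.symm_swap, Equiv.swap_apply_def]
  split_ifs with h1 h2
  · subst h1; exact hij.symm
  · subst h2; exact hij
  · rfl

theorem map_swap_of_notMem {i j : Fin d} {T : Finset (Fin d)} (hi : i ∉ T) (hj : j ∉ T) :
    (insert i T).map (Equiv.swap i j).toEmbedding = insert j T := by
  rw [map_insert, map_swap_eq_self (by simp [hi, hj])]
  simp

theorem apply_map_swap {v : SetFunction d} {i j : Fin d}
    (hv : ∀ S : Finset (Fin d), i ∉ S → j ∉ S → v (insert i S) = v (insert j S))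
    (S : Finset (Fin d)) : v (S.map (Equiv.swap i j).toEmbedding) = v S := by
  by_cases hi : i ∈ S <;> by_cases hj : j ∈ S
  · rw [map_swap_eq_self (by simp [hi, hj])]
  · have hj' : j ∉ S.erase i := fun h => hj (mem_of_mem_erase h)
    conv_lhs => rw [← insert_erase hi]
    rw [map_swap_of_notMem (notMem_erase i S) hj', ← hv _ (notMem_erase i S) hj', insert_erase hi]
  · have hi' : i ∉ S.erase j := fun h => hi (mem_of_mem_erase h)
    conv_lhs => rw [← insert_erase hj]
    rw [Equiv.swap_comm, map_swap_of_notMem (notMem_erase j S) hi', hv _ hi' (notMem_erase j S),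
      insert_erase hj]
  · rw [map_swap_eq_self (by simp [hi, hj])]

end Moebius

/-! ### The closed form solves the normal equations -/

section ClosedForm

variable {d : ℕ}

/-- The Faith-Shap index, defined by its closed form. -/
noncomputable def faithShap (d : ℕ) : InteractionIndex d := fun v l S =>
  moebiusTransform v S.1 + ∑ T : Finset (Fin d) with S.1 ⊂ T ∧ l.1 < T.card,
    shapCoeff l.1 T.card S.1.card * moebiusTransform v T

theorem sum_powerset_card_le {α : Type*} (A : Finset α) (l : ℕ) (f : ℕ → ℝ) :
    ∑ T ∈ A.powerset with T.card ≤ l, f T.card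
      = ∑ s ∈ range (l + 1), (A.card.choose s : ℝ) * f s := by
  rw [sum_filter, sum_powerset_apply_card (fun j => if j ≤ l then f j else 0)]
  have h1 : range (A.card + 1) ⊆ range (A.card + l + 1) := range_mono (by omega)
  have h2 : range (l + 1) ⊆ range (A.card + l + 1) := range_mono (by omega)
  rw [sum_subset h1 fun s _ hs => by
    rw [Nat.choose_eq_zero_of_lt (by simpa using hs), zero_smul]]
  refine (sum_subset_zero_on_sdiff h2 (fun s hs => ?_) fun s hs => ?_).symm
  · have h := (mem_sdiff.1 hs).2
    rw [mem_range, Nat.lt_succ_iff] at h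
    rw [if_neg h, smul_zero]
  · rw [if_pos (Nat.lt_succ_iff.1 (mem_range.1 hs)), nsmul_eq_mul]

/-- The residual of the closed form is a combination of the residuals of unanimity games. -/
theorem sub_polynomialFit_faithShap (v : SetFunction d) (l : InteractionOrder d)
    (S : Finset (Fin d)) :
    v S - polynomialFit (faithShap d v l) S
      = ∑ R : Finset (Fin d) with l.1 < R.card,
          moebiusTransform v R * shapResidual l.1 R.card (S ∩ R).card := by
  have hfit : polynomialFit (faithShap d v l) S
      = ∑ T ∈ S.powerset with T.card ≤ l.1, moebiusTransform v T
        + ∑ T ∈ S.powerset with T.card ≤ l.1,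
          ∑ R : Finset (Fin d) with T ⊂ R ∧ l.1 < R.card,
            shapCoeff l.1 R.card T.card * moebiusTransform v R := by
    rw [← sum_add_distrib]
    unfold polynomialFit faithShap
    rw [sum_smallSubset (l := l.1) fun T => if T ⊆ S then moebiusTransform v T +
      ∑ R : Finset (Fin d) with T ⊂ R ∧ l.1 < R.card,
        shapCoeff l.1 R.card T.card * moebiusTransform v R else 0]
    rw [← sum_filter]
    refine sum_congr ?_ fun _ _ => rfl
    ext T
    simp [and_comm]
  have hcomm : ∑ T ∈ S.powerset with T.card ≤ l.1,
        ∑ R : Finset (Fin d) with T ⊂ R ∧ l.1 < R.card,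
          shapCoeff l.1 R.card T.card * moebiusTransform v R
      = ∑ R : Finset (Fin d) with l.1 < R.card, moebiusTransform v R *
          ∑ s ∈ range (l.1 + 1), ((S ∩ R).card.choose s : ℝ) * shapCoeff l.1 R.card s := by
    rw [sum_comm' (t' := univ.filter fun R : Finset (Fin d) => l.1 < R.card)
      (s' := fun R => (S ∩ R).powerset.filter fun T => T.card ≤ l.1)]
    · refine sum_congr rfl fun R _ => ?_
      rw [← sum_powerset_card_le, mul_sum]
      exact sum_congr rfl fun T _ => mul_comm _ _
    · intro T R
      simp only [mem_filter, mem_powerset, mem_univ, true_and, subset_inter_iff]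
      constructor
      · rintro ⟨⟨h1, h2⟩, h3, h4⟩
        exact ⟨⟨⟨h1, h3.subset⟩, h2⟩, h4⟩
      · rintro ⟨⟨⟨h1, h3⟩, h2⟩, h4⟩
        refine ⟨⟨h1, h2⟩, h3.ssubset_of_ne ?_, h4⟩
        rintro rfl
        omega
  have hv : v S = ∑ T ∈ S.powerset with T.card ≤ l.1, moebiusTransform v T
      + ∑ R : Finset (Fin d) with l.1 < R.card,
          moebiusTransform v R * (if (S ∩ R).card = R.card then 1 else 0) := by
    rw [← sum_moebiusTransform v S, ← sum_filter_add_sum_filter_not S.powerset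
      (fun T => T.card ≤ l.1)]
    congr 1
    simp only [mul_ite, mul_one, mul_zero]
    rw [← sum_filter]
    refine sum_congr ?_ fun _ _ => rfl
    ext R
    simp only [mem_filter, mem_powerset, not_le, mem_univ, true_and]
    rw [and_comm]
    refine and_congr_right fun _ => ?_
    constructor
    · intro h
      rw [inter_eq_right.2 h]
    · intro h
      exact inter_eq_right.1 (eq_of_subset_of_card_le inter_subset_right h.ge)
  rw [hfit, hcomm, hv, add_sub_add_left_eq_sub, ← sum_sub_distrib]
  refine sum_congr rfl fun R _ => ?_
  rw [shapResidual]
  ring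

theorem polynomialFit_faithShap_empty (v : SetFunction d) (l : InteractionOrder d) :
    polynomialFit (faithShap d v l) ∅ = v ∅ := by
  refine (sub_eq_zero.1 ?_).symm
  rw [sub_polynomialFit_faithShap]
  refine sum_eq_zero fun R hR => ?_
  rw [empty_inter, card_empty, shapResidual_zero (mem_filter.1 hR).2, mul_zero]

theorem polynomialFit_faithShap_univ (v : SetFunction d) (l : InteractionOrder d) :
    polynomialFit (faithShap d v l) univ = v univ := by
  refine (sub_eq_zero.1 ?_).symm
  rw [sub_polynomialFit_faithShap]
  refine sum_eq_zero fun R hR => ?_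
  rw [univ_inter, shapResidual_self l.2.1 (mem_filter.1 hR).2, mul_zero]

/-- With maximal order `d` the fit is exact. -/
theorem polynomialFit_faithShap_of_eq (v : SetFunction d) (l : InteractionOrder d) (hl : l.1 = d)
    (S : Finset (Fin d)) : polynomialFit (faithShap d v l) S = v S := by
  refine (sub_eq_zero.1 ?_).symm
  rw [sub_polynomialFit_faithShap]
  refine sum_eq_zero fun R hR => ?_
  have h1 := (mem_filter.1 hR).2
  have h2 := card_le_univ R
  rw [Fintype.card_fin] at h2
  omega

/-- The residual of a unanimity game is orthogonal, for Beta weights, to every polynomial of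
degree at most `l` that vanishes at `∅` and at `univ`. -/
theorem sum_beta_mul_shapResidual_mul_polynomialFit {l : ℕ} (hl : 1 ≤ l) (R : Finset (Fin d))
    (hR : l < R.card) (y : SmallSubset d l → ℝ) (hy0 : polynomialFit y ∅ = 0)
    (hy1 : polynomialFit y univ = 0) :
    ∑ S : Finset (Fin d), beta S.card (d - S.card) *
      shapResidual l R.card (S ∩ R).card * polynomialFit y S = 0 := by
  have hN : ∀ T : SmallSubset d l, T.1 ≠ ∅ →
      ∑ S : Finset (Fin d) with T.1 ⊆ S,
        beta S.card (d - S.card) * shapResidual l R.card (S ∩ R).card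
      = residualMoment l R.card 1 0 := by
    intro T hT
    have hcard : (T.1 \ R).card + (T.1 ∩ R).card = T.1.card := card_sdiff_add_card_inter _ _
    have hpos : 1 ≤ T.1.card := card_pos.2 (nonempty_iff_ne_empty.2 hT)
    have h := sum_beta_mul_shapResidual hl R T.1 hR
    rw [residualMoment_eq hl hR _ _ (by omega) (by have := T.2; omega)] at h
    have hch : (0 : ℝ) < R.card.choose (T.1 ∩ R).card := by
      exact_mod_cast Nat.choose_pos (card_le_card inter_subset_right)
    exact mul_left_cancel₀ hch.ne' h
  have hswap : ∑ S : Finset (Fin d), beta S.card (d - S.card) *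
      shapResidual l R.card (S ∩ R).card * polynomialFit y S
      = ∑ T : SmallSubset d l, y T * ∑ S : Finset (Fin d) with T.1 ⊆ S,
        beta S.card (d - S.card) * shapResidual l R.card (S ∩ R).card := by
    simp only [polynomialFit, mul_sum, sum_filter]
    rw [sum_comm]
    refine sum_congr rfl fun T _ => sum_congr rfl fun S _ => ?_
    split_ifs <;> ring
  have hconst : ∀ T : SmallSubset d l, y T * ∑ S : Finset (Fin d) with T.1 ⊆ S,
        beta S.card (d - S.card) * shapResidual l R.card (S ∩ R).card
      = y T * residualMoment l R.card 1 0 := by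
    intro T
    by_cases hT : T.1 = ∅
    · have : y T = 0 := by
        rw [polynomialFit_empty] at hy0
        rw [← hy0]
        congr 1
        exact Subtype.ext hT
      rw [this, zero_mul, zero_mul]
    · rw [hN T hT]
  rw [hswap, sum_congr rfl fun T _ => hconst T, ← sum_mul, ← polynomialFit_univ, hy1, zero_mul]

/-- Weights that are Beta weights on the proper nonempty sets make the closed form orthogonal to
all admissible polynomials. -/
theorem sum_weight_mul_residual_eq_zero (w : Finset (Fin d) → ℝ) (c : ℝ)
    (hw : ∀ S : Finset (Fin d), 1 ≤ S.card → S.card < d → w S = c * beta S.card (d - S.card))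
    (v : SetFunction d) (l : InteractionOrder d) (y : SmallSubset d l.1 → ℝ)
    (hy0 : polynomialFit y ∅ = 0) (hy1 : polynomialFit y univ = 0) :
    ∑ S, w S * ((v S - polynomialFit (faithShap d v l) S) * polynomialFit y S) = 0 := by
  have h1 : ∀ S, w S * ((v S - polynomialFit (faithShap d v l) S) * polynomialFit y S)
      = ∑ R : Finset (Fin d) with l.1 < R.card, c * moebiusTransform v R *
        (beta S.card (d - S.card) * shapResidual l.1 R.card (S ∩ R).card * polynomialFit y S) := by
    intro S
    have h2 : w S * ((v S - polynomialFit (faithShap d v l) S) * polynomialFit y S)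
        = c * beta S.card (d - S.card) *
          ((v S - polynomialFit (faithShap d v l) S) * polynomialFit y S) := by
      rcases S.eq_empty_or_nonempty with rfl | hne
      · rw [hy0]; ring
      rcases eq_or_ne S univ with rfl | hun
      · rw [hy1]; ring
      rw [hw S (card_pos.2 hne) (card_lt_of_ne_univ hun)]
    rw [h2, sub_polynomialFit_faithShap, sum_mul, mul_sum]
    exact sum_congr rfl fun R _ => by ring
  rw [sum_congr rfl fun S _ => h1 S, sum_comm]
  refine sum_eq_zero fun R hR => ?_
  rw [← mul_sum,
    sum_beta_mul_shapResidual_mul_polynomialFit l.2.1 R (mem_filter.1 hR).2 y hy0 hy1, mul_zero]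

end ClosedForm

/-! ### Faith-Shap weightings -/

section Weightings

variable {d : ℕ}

theorem weight_eq_beta {s : ℕ} (hs : 1 ≤ s) (hsd : s < d) :
    ((d : ℝ) - 1) / ((d.choose s : ℝ) * (s : ℝ) * ((d : ℝ) - (s : ℝ)))
      = ((d : ℝ) - 1) / d * beta s (d - s) := by
  obtain ⟨n, rfl⟩ : ∃ n, d = s + (n + 1) := ⟨d - s - 1, by omega⟩
  obtain ⟨s, rfl⟩ : ∃ m, s = m + 1 := ⟨s - 1, by omega⟩
  unfold beta
  rw [Nat.cast_choose ℝ (by omega), show s + 1 + (n + 1) - (s + 1) = n + 1 by omega,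
    show s + 1 + (n + 1) - 1 = s + n + 1 by omega, show s + 1 + (n + 1) = (s + n + 1) + 1 by omega,
    Nat.factorial_succ (s + n + 1), Nat.factorial_succ s, Nat.factorial_succ n,
    Nat.add_sub_cancel, Nat.add_sub_cancel]
  push_cast
  have h1 : (s : ℝ) + n + 1 + 1 - (s + 1) = n + 1 := by ring
  rw [h1]
  field_simp

theorem isProperWeighting_of_isFaithShapWeighting {μ : Finset (Fin d) → ENNReal}
    (hμ : IsFaithShapWeighting μ) : IsProperWeighting μ := by
  obtain ⟨h0, h1, c, hc, h⟩ := hμ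
  refine ⟨fun S => ?_, fun S hS hSd => by rw [h S hS hSd]; exact ENNReal.ofReal_ne_top⟩
  rcases S.eq_empty_or_nonempty with rfl | hne
  · simp [h0]
  rcases eq_or_ne S univ with rfl | hun
  · simp [h1]
  have hS := card_pos.2 hne
  have hSd := card_lt_of_ne_univ hun
  have hd : (0 : ℝ) < (d : ℝ) - 1 := by
    have : (1 : ℝ) < d := by exact_mod_cast (by omega : 1 < d)
    linarith
  rw [h S hS hSd, ENNReal.ofReal_pos, weight_eq_beta hS hSd]
  have := beta_pos S.card (d - S.card)
  have : (0 : ℝ) < d := by linarith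
  positivity

/-- The fit interpolates at `∅` and `univ`, so the closed form is feasible, and the weights are
proportional to Beta weights elsewhere. -/
theorem isFaithfulFor_faithShap {μ : Finset (Fin d) → ENNReal} (hμ : IsFaithShapWeighting μ) :
    IsFaithfulFor μ (faithShap d) := by
  intro v l
  have hprop := isProperWeighting_of_isFaithShapWeighting hμ
  obtain ⟨h0, h1, c, hc, h⟩ := hμ
  rw [isRegressionMinimizer_iff]
  refine ⟨fun S hS => ?_, fun y hy => ?_⟩
  · rcases S.eq_empty_or_nonempty with rfl | hne
    · rw [polynomialFit_faithShap_empty]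
    rcases eq_or_ne S univ with rfl | hun
    · rw [polynomialFit_faithShap_univ]
    exact absurd hS (hprop.2 S (card_pos.2 hne) (card_lt_of_ne_univ hun))
  · refine sum_weight_mul_residual_eq_zero _ (c * (((d : ℝ) - 1) / d)) (fun S hS hSd => ?_) v l y
      (hy _ h0) (hy _ h1)
    rw [h S hS hSd, weight_eq_beta hS hSd, ENNReal.toReal_ofReal, mul_assoc]
    have hd : (0 : ℝ) ≤ (d : ℝ) - 1 := by
      have : (1 : ℝ) < d := by exact_mod_cast (by omega : 1 < d)
      linarith
    have := beta_pos S.card (d - S.card)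
    positivity

theorem exists_isFaithShapWeighting (d : ℕ) :
    ∃ μ : Finset (Fin d) → ENNReal, IsFaithShapWeighting μ := by
  classical
  refine ⟨fun S => if S = ∅ ∨ S = univ then ⊤ else ENNReal.ofReal
      (1 * (((d : ℝ) - 1) / ((d.choose S.card : ℝ) * (S.card : ℝ) * ((d : ℝ) - (S.card : ℝ))))),
    by simp, by simp, 1, one_pos, fun S hS hSd => if_neg ?_⟩
  rintro (rfl | rfl)
  · simp at hS
  · simp at hSd

end Weightings

/-! ### The axioms for the closed form -/

section Axioms

variable {d : ℕ}

theorem faithShap_linearity : InteractionLinearity (faithShap d) := by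
  intro l v₁ v₂ α₁ α₂
  funext S
  simp only [faithShap, moebiusTransform_linear, Pi.add_apply, Pi.smul_apply, smul_eq_mul, mul_add,
    sum_add_distrib, mul_sum]
  have h : ∀ (α : ℝ) (v : SetFunction d), ∑ T : Finset (Fin d) with S.1 ⊂ T ∧ l.1 < T.card,
      shapCoeff l.1 T.card S.1.card * (α * moebiusTransform v T)
      = ∑ T : Finset (Fin d) with S.1 ⊂ T ∧ l.1 < T.card,
        α * (shapCoeff l.1 T.card S.1.card * moebiusTransform v T) :=
    fun α v => sum_congr rfl fun T _ => by ring
  rw [h, h]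
  ring

theorem faithShap_symmetry : InteractionSymmetry (faithShap d) := by
  intro l v i j hv T hT hi hj
  set σ := Equiv.swap i j
  have hσ := apply_map_swap hv
  have hmap : insert j T = (insert i T).map σ.toEmbedding := (map_swap_of_notMem hi hj).symm
  simp only [faithShap, hmap, moebiusTransform_map σ hσ, card_map]
  congr 1
  refine sum_equiv σ.finsetCongr (fun R => ?_) fun R _ => ?_
  · simp only [mem_filter, mem_univ, true_and, Equiv.finsetCongr_apply, card_map, map_ssubset_map]
  · simp [moebiusTransform_map σ hσ]

theorem faithShap_dummy : InteractionDummy (faithShap d) := by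
  intro l v i hv T hi
  rw [faithShap, moebiusTransform_eq_zero_of_dummy hv hi, zero_add]
  refine sum_eq_zero fun R hR => ?_
  rw [moebiusTransform_eq_zero_of_dummy hv ((mem_filter.1 hR).2.1.subset hi), mul_zero]

theorem faithShap_efficiency : InteractionEfficiency (faithShap d) := by
  intro l v
  have h0 : faithShap d v l ⟨∅, Nat.zero_le l.1⟩ = v ∅ :=
    (polynomialFit_empty _).symm.trans (polynomialFit_faithShap_empty v l)
  refine ⟨?_, h0⟩
  rw [← polynomialFit_faithShap_univ v l, polynomialFit_univ, ← h0,
    ← sum_erase_eq_sub (mem_univ _), ← sum_erase univ (a := ⟨∅, Nat.zero_le l.1⟩) (by simp)]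
  refine sum_congr rfl fun S hS => if_neg fun h => ?_
  exact ne_of_mem_erase hS (Subtype.ext h)

theorem faithShap_satisfiesShapleyAxioms : SatisfiesShapleyAxioms (faithShap d) :=
  ⟨faithShap_linearity, faithShap_symmetry, faithShap_dummy, faithShap_efficiency⟩

end Axioms

/-! ### Top-order terms -/

section TopOrder

variable {d : ℕ}

theorem topOrderWeight_eq_beta {l t : ℕ} (hl : 1 ≤ l) (ht : t < d) :
    topOrderWeight d l t
      = ((2 * l - 1).factorial : ℝ) / ((l - 1).factorial : ℝ) ^ 2 * beta (l + t) (d - t) := by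
  unfold topOrderWeight beta
  rw [show l + t + (d - t) - 1 = d + l - 1 by omega]

theorem topOrderWeight_pos (d l t : ℕ) : 0 < topOrderWeight d l t := by
  unfold topOrderWeight
  positivity

/-- Summing out the elements outside `S ∪ U` leaves a single Beta weight. -/
theorem sum_topOrderWeight_superset {l : ℕ} (hl : 1 ≤ l) {S U : Finset (Fin d)} (hS : S.card = l)
    (hU : U ⊆ Sᶜ) :
    ∑ T ∈ (Sᶜ).powerset with U ⊆ T, topOrderWeight d l T.card
      = ((2 * l - 1).factorial : ℝ) / ((l - 1).factorial : ℝ) ^ 2 *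
        beta (l + U.card) l := by
  rw [sum_superset hU, ← sum_powerset_beta (Sᶜ \ U) (by omega) hl, mul_sum]
  refine sum_congr rfl fun W hW => ?_
  have hW := mem_powerset.1 hW
  have h1 := card_sdiff_of_subset hU
  have h2 := card_le_card hU
  have h3 := card_le_card hW
  rw [card_compl, Fintype.card_fin] at h1 h2
  have h4 : S.card ≤ d := by simpa using card_le_univ S
  rw [card_union_of_disjoint (disjoint_of_subset_right hW disjoint_sdiff),
    topOrderWeight_eq_beta hl (by omega)]
  congr 2 <;> omega

theorem sum_topOrderWeight {l : ℕ} (hl : 1 ≤ l) {S : Finset (Fin d)} (hS : S.card = l) :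
    ∑ T ∈ (Sᶜ).powerset, topOrderWeight d l T.card = 1 := by
  have h := sum_topOrderWeight_superset hl hS (empty_subset Sᶜ)
  simp only [empty_subset, filter_true, card_empty, add_zero] at h
  rw [h, beta, ← two_mul]
  field_simp

theorem sum_topOrderWeight_superset_eq_shapCoeff {l : ℕ} (hl : 1 ≤ l) {S U : Finset (Fin d)}
    (hS : S.card = l)
   
    (hU : U ⊆ Sᶜ) (hne : U.Nonempty) :
    ∑ T ∈ (Sᶜ).powerset with U ⊆ T, topOrderWeight d l T.card
      = shapCoeff l (l + U.card) l := by
  rw [sum_topOrderWeight_superset hl hS hU]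
  have hu : 1 ≤ U.card := card_pos.2 hne
  generalize U.card = u at hu
  obtain ⟨u, rfl⟩ := Nat.exists_eq_add_of_le' hu
  obtain ⟨l, rfl⟩ := Nat.exists_eq_add_of_le' hl
  unfold shapCoeff beta
  rw [Nat.cast_choose ℝ (by omega), Nat.cast_choose ℝ (by omega),
    show l + 1 + (u + 1) - 1 - (l + 1) = u by omega,
    Nat.cast_choose ℝ (show l + 1 + (l + 1) ≤ _ by omega),
    show l + 1 + (u + 1) + (l + 1) - 1 - (l + 1 + (l + 1)) = u by omega, Nat.sub_self,
    show l + 1 + (l + 1) = (2 * (l + 1) - 1) + 1 by omega,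
    Nat.factorial_succ (2 * (l + 1) - 1), show 2 * (l + 1) - 1 + 1 = 2 * (l + 1) by omega,
    Nat.add_sub_cancel, Nat.factorial_succ l]
  push_cast
  field_simp
  ring

/-- The top-order terms of the closed form are weighted averages of discrete derivatives. -/
theorem faithShap_topOrder (v : SetFunction d) (l : InteractionOrder d) (S : SmallSubset d l.1)
    (hS : S.1.card = l.1) :
    faithShap d v l S = ∑ T ∈ (S.1ᶜ).powerset,
      topOrderWeight d l.1 T.card * discreteDerivative v S.1 T := by
  have hl := l.2.1
  have h1 : ∀ T ∈ (S.1ᶜ).powerset, topOrderWeight d l.1 T.card * discreteDerivative v S.1 T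
      = ∑ U ∈ T.powerset, topOrderWeight d l.1 T.card * moebiusTransform v (S.1 ∪ U) := by
    intro T hT
    rw [discreteDerivative_eq_sum_moebiusTransform v T S.1
      (disjoint_of_subset_right (mem_powerset.1 hT) disjoint_compl_right), mul_sum]
  rw [sum_congr rfl h1, sum_comm' (t' := (S.1ᶜ).powerset)
    (s' := fun U => (S.1ᶜ).powerset.filter fun T => U ⊆ T)]
  · simp only [← sum_mul]
    rw [← sum_erase_add _ _ (empty_mem_powerset S.1ᶜ)]
    simp only [empty_subset, filter_true, sum_topOrderWeight hl hS, one_mul, union_empty]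
    rw [faithShap, add_comm]
    congr 1
    refine sum_nbij' (fun T => T \ S.1) (fun U => S.1 ∪ U) ?_ ?_ ?_ ?_ ?_
    · intro T hT
      have h := (mem_filter.1 hT).2.1
      rw [mem_erase, mem_powerset]
      refine ⟨(sdiff_nonempty.2 h.2).ne_empty, ?_⟩
      exact fun x hx => mem_compl.2 (mem_sdiff.1 hx).2
    · intro U hU
      rw [mem_erase, mem_powerset] at hU
      have hdisj : Disjoint S.1 U := disjoint_of_subset_right hU.2 disjoint_compl_right
      have hpos := card_pos.2 (nonempty_iff_ne_empty.2 hU.1)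
      have hlt : S.1.card < (S.1 ∪ U).card := by
        rw [card_union_of_disjoint hdisj]
        omega
      rw [mem_filter]
      refine ⟨mem_univ _, subset_union_left.ssubset_of_ne fun h => ?_, hS.symm.trans_lt hlt⟩
      rw [← h] at hlt
      exact lt_irrefl _ hlt
    · intro T hT
      exact union_sdiff_of_subset (mem_filter.1 hT).2.1.subset
    · intro U hU
      rw [mem_erase, mem_powerset] at hU
      exact union_sdiff_cancel_left (disjoint_of_subset_right hU.2 disjoint_compl_right)
    · intro T hT
      have h := (mem_filter.1 hT).2.1
      rw [sum_topOrderWeight_superset_eq_shapCoeff hl hS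
        (fun x hx => mem_compl.2 (mem_sdiff.1 hx).2) (sdiff_nonempty.2 h.2),
        union_sdiff_of_subset h.subset, hS]
      congr 2
      have := card_sdiff_add_card_eq_card h.subset
      omega
  · intro T U
    simp only [mem_powerset, mem_filter]
    exact ⟨fun h => ⟨⟨h.1, h.2⟩, h.2.trans h.1⟩, fun h => ⟨h.1.1, h.1.2⟩⟩

end TopOrder

/-! ### Indices of first order -/

section FirstOrder

variable {d : ℕ}

theorem sum_smallSubset_one (F : SmallSubset d 1 → ℝ) :
    ∑ T, F T = F ⟨∅, Nat.zero_le 1⟩ + ∑ i : Fin d, F ⟨{i}, (card_singleton i).le⟩ := by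
  let e : Option (Fin d) → SmallSubset d 1 := fun o =>
    o.elim ⟨∅, Nat.zero_le 1⟩ fun i => ⟨{i}, (card_singleton i).le⟩
  have he : Function.Bijective e := by
    constructor
    · rintro (_ | i) (_ | j) h
      · rfl
      · exact absurd (congrArg Subtype.val h).symm (singleton_ne_empty j)
      · exact absurd (congrArg Subtype.val h) (singleton_ne_empty i)
      · exact congrArg some (singleton_injective (congrArg Subtype.val h))
    · rintro ⟨T, hT⟩
      rcases Nat.le_one_iff_eq_zero_or_eq_one.1 hT with h | h
      · exact ⟨none, Subtype.ext (card_eq_zero.1 h).symm⟩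
      · obtain ⟨i, rfl⟩ := card_eq_one.1 h
        exact ⟨some i, rfl⟩
  rw [← he.sum_comp F, Fintype.sum_option]
  rfl

theorem polynomialFit_one (x : SmallSubset d 1 → ℝ) (S : Finset (Fin d)) :
    polynomialFit x S
      = x ⟨∅, Nat.zero_le 1⟩ + ∑ i ∈ S, x ⟨{i}, (card_singleton i).le⟩ := by
  unfold polynomialFit
  rw [sum_smallSubset_one fun T => if T.1 ⊆ S then x T else 0]
  simp

/-- The coefficients of the affine function `S ↦ a + ∑ i ∈ S, b i`. -/
def affineCoeff (a : ℝ) (b : Fin d → ℝ) : SmallSubset d 1 → ℝ :=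
  fun T => if T.1 = ∅ then a else ∑ i ∈ T.1, b i

theorem polynomialFit_affineCoeff (a : ℝ) (b : Fin d → ℝ) (S : Finset (Fin d)) :
    polynomialFit (affineCoeff a b) S = a + ∑ i ∈ S, b i := by
  simp [polynomialFit_one, affineCoeff]

/-- The game that is `1` on `R` and `0` on every other set. -/
def diracGame (R : Finset (Fin d)) : SetFunction d := fun S => if S = R then 1 else 0

/-- The first-order index of player `i`, for the maximal interaction order `1`. -/
def firstOrderValue (E : InteractionIndex d) (hd : 1 ≤ d) (v : SetFunction d) (i : Fin d) : ℝ :=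
  E v ⟨1, le_rfl, hd⟩ ⟨{i}, (card_singleton i).le⟩

variable {E : InteractionIndex d}

theorem polynomialFit_firstOrder (hE : InteractionEfficiency E) (hd : 1 ≤ d) (v : SetFunction d)
    (S : Finset (Fin d)) :
    polynomialFit (E v ⟨1, le_rfl, hd⟩) S = v ∅ + ∑ i ∈ S, firstOrderValue E hd v i := by
  have h := (hE ⟨1, le_rfl, hd⟩ v).2
  rw [polynomialFit_one (E v ⟨1, le_rfl, hd⟩) S]
  exact congrArg₂ _ h rfl

theorem sum_firstOrderValue (hE : InteractionEfficiency E) (hd : 1 ≤ d) (v : SetFunction d) :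
    ∑ i, firstOrderValue E hd v i = v univ - v ∅ := by
  have h := (hE ⟨1, le_rfl, hd⟩ v).1
  rw [← h, sum_smallSubset_one fun S => if S.1 = ∅ then 0 else E v ⟨1, le_rfl, hd⟩ S]
  simp [firstOrderValue]

theorem firstOrderValue_symm (hE : InteractionSymmetry E) (hd : 1 ≤ d) {v : SetFunction d}
    {i j : Fin d}
    (hv : ∀ S : Finset (Fin d), i ∉ S → j ∉ S → v (insert i S) = v (insert j S)) :
    firstOrderValue E hd v i = firstOrderValue E hd v j :=
  hE ⟨1, le_rfl, hd⟩ v i j hv ∅ (by simp) (notMem_empty i) (notMem_empty j)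

theorem firstOrderValue_diracGame_eq (hE : InteractionSymmetry E) (hd : 1 ≤ d)
    {R : Finset (Fin d)} {i j : Fin d} (hij : i ∈ R ↔ j ∈ R) :
    firstOrderValue E hd (diracGame R) i = firstOrderValue E hd (diracGame R) j := by
  rcases eq_or_ne i j with rfl | hne
  · rfl
  refine firstOrderValue_symm hE hd fun S hi hj => ?_
  have h1 : insert i S ≠ R := by
    rintro rfl
    have := hij.1 (mem_insert_self i S)
    exact (mem_insert.1 this).elim (fun h => hne h.symm) hj
  have h2 : insert j S ≠ R := by
    rintro rfl
    have := hij.2 (mem_insert_self j S)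
    exact (mem_insert.1 this).elim hne hi
  simp [diracGame, h1, h2]

/-- Player `j` is a dummy in the sum of the Dirac games of `R` and of `insert j R`. -/
theorem firstOrderValue_diracGame_insert (hL : InteractionLinearity E) (hD : InteractionDummy E)
    (hd : 1 ≤ d) {R : Finset (Fin d)} {j : Fin d} (hj : j ∉ R) :
    firstOrderValue E hd (diracGame R) j = -firstOrderValue E hd (diracGame (insert j R)) j := by
  have hlin := congrFun (hL ⟨1, le_rfl, hd⟩ (diracGame R) (diracGame (insert j R)) 1 1)
    ⟨{j}, (card_singleton j).le⟩
  have hdum := hD ⟨1, le_rfl, hd⟩ ((1 : ℝ) • diracGame R + (1 : ℝ) • diracGame (insert j R)) j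
    (fun S hS => ?_) ⟨{j}, (card_singleton j).le⟩ (mem_singleton_self j)
  · rw [hdum] at hlin
    simp only [one_smul, Pi.add_apply] at hlin
    exact eq_neg_of_add_eq_zero_left hlin.symm
  · have h1 : insert j S ≠ R := by
      rintro rfl
      exact hj (mem_insert_self j S)
    have h2 : S ≠ insert j R := by
      rintro rfl
      exact hS (mem_insert_self j R)
    have h3 : insert j S = insert j R ↔ S = R := by
      constructor
      · intro h
        rw [← erase_insert hS, h, erase_insert hj]
      · rintro rfl; rfl
    simp [diracGame, h1, h2, h3]

/-- The axioms determine the first-order index on Dirac games: it is the Shapley value. Starting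
from `R = univ`, the dummy axiom gives the values outside `R` from those for larger sets, and
symmetry and efficiency then give the values inside `R`. -/
theorem firstOrderValue_diracGame_of_mem (hE : SatisfiesShapleyAxioms E) (hd : 1 ≤ d) :
    ∀ (n : ℕ) (R : Finset (Fin d)), R.card + n = d → ∀ i ∈ R,
      firstOrderValue E hd (diracGame R) i = beta R.card (d - R.card + 1) := by
  obtain ⟨hL, hS, hD, hEff⟩ := hE
  intro n
  induction n with
  | zero =>
    intro R hR i hi
    have hRu : R = univ := (card_eq_iff_eq_univ R).1 (by simpa using hR)
    subst hRu
    have hsum := sum_firstOrderValue hEff hd (diracGame univ)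
    rw [sum_congr rfl fun j _ => firstOrderValue_diracGame_eq hS hd (i := j) (j := i) (by simp)]
      at hsum
    have hne : (univ : Finset (Fin d)) ≠ ∅ := ⟨i, mem_univ i⟩ |> nonempty_iff_ne_empty.1
    simp only [sum_const, card_univ, Fintype.card_fin, nsmul_eq_mul, diracGame, if_true,
      if_neg hne.symm, sub_zero] at hsum
    have hd0 : (d : ℝ) ≠ 0 := by positivity
    rw [card_univ, Fintype.card_fin, Nat.sub_self, zero_add, beta_one_right hd, eq_div_iff hd0,
      mul_comm]
    exact hsum
  | succ n ih =>
    intro R hR i hi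
    have hRu : R ≠ univ := by
      rintro rfl
      simp at hR
    have hR0 : R ≠ ∅ := by
      rintro rfl
      exact absurd hi (notMem_empty i)
    have hsum := sum_firstOrderValue hEff hd (diracGame R)
    have hout : ∀ j ∈ Rᶜ, firstOrderValue E hd (diracGame R) j =
        -beta (R.card + 1) (d - R.card) := by
      intro j hj
      have hj := mem_compl.1 hj
      rw [firstOrderValue_diracGame_insert hL hD hd hj,
        ih (insert j R) (by rw [card_insert_of_notMem hj]; omega) j (mem_insert_self j R),
        card_insert_of_notMem hj]
      congr 2
      omega
    have hin : ∀ j ∈ R, firstOrderValue E hd (diracGame R) j =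
        firstOrderValue E hd (diracGame R) i :=
      fun j hj => firstOrderValue_diracGame_eq hS hd (by simp [hi, hj])
    rw [← sum_add_sum_compl R, sum_congr rfl hin, sum_congr rfl hout] at hsum
    simp only [sum_const, card_compl, Fintype.card_fin, nsmul_eq_mul, diracGame,
      if_neg hRu.symm, if_neg hR0.symm, sub_zero] at hsum
    have hr : 1 ≤ R.card := card_pos.2 ⟨i, hi⟩
    have hr' : (0 : ℝ) < R.card := by exact_mod_cast hr
    have hb : 1 ≤ d - R.card := by omega
    have h1 := add_mul_beta_succ_left hr hb
    have h2 := add_mul_beta_succ_right hr hb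
    have hpos : (0 : ℝ) < (R.card : ℝ) + (d - R.card : ℕ) := by positivity
    refine mul_left_cancel₀ (mul_pos hr' hpos).ne' ?_
    linear_combination ((R.card : ℝ) + (d - R.card : ℕ)) * hsum
      + ((d - R.card : ℕ) : ℝ) * h1 - (R.card : ℝ) * h2

theorem firstOrderValue_diracGame_of_notMem (hE : SatisfiesShapleyAxioms E) (hd : 1 ≤ d)
    {R : Finset (Fin d)} {j : Fin d} (hj : j ∉ R) :
    firstOrderValue E hd (diracGame R) j = -beta (R.card + 1) (d - R.card) := by
  have hcard : (insert j R).card ≤ d := by simpa using card_le_univ (insert j R)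
  rw [firstOrderValue_diracGame_insert hE.1 hE.2.2.1 hd hj,
    firstOrderValue_diracGame_of_mem hE hd (d - (insert j R).card) _ (by omega) j
      (mem_insert_self j R)]
  rw [card_insert_of_notMem hj] at hcard ⊢
  congr 2
  omega

/-- The indicator of `i`, made to vanish at `univ`. -/
noncomputable def centredIndicator (i : Fin d) (S : Finset (Fin d)) : ℝ :=
  (if i ∈ S then 1 else 0) - (S.card : ℝ) / d

theorem polynomialFit_centredIndicator (i : Fin d) (S : Finset (Fin d)) :
    polynomialFit (affineCoeff 0 fun j => (if j = i then 1 else 0) - 1 / (d : ℝ)) S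
      = centredIndicator i S := by
  rw [polynomialFit_affineCoeff, zero_add, sum_sub_distrib, sum_ite_eq', centredIndicator]
  simp [div_eq_mul_inv]

/-- The first-order fit of a Dirac game is a multiple of a sum of centred indicators. -/
theorem polynomialFit_diracGame (hE : SatisfiesShapleyAxioms E) (hd : 1 ≤ d) {R : Finset (Fin d)}
    (hR : 1 ≤ R.card) (hRd : R.card < d) (S : Finset (Fin d)) :
    polynomialFit (E (diracGame R) ⟨1, le_rfl, hd⟩) S
      = beta R.card (d - R.card) * ∑ k ∈ R, centredIndicator k S := by
  have hb : 1 ≤ d - R.card := by omega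
  have hR0 : R ≠ ∅ := nonempty_iff_ne_empty.1 (card_pos.1 hR)
  have hval : ∀ i, firstOrderValue E hd (diracGame R) i
      = (if i ∈ R then beta R.card (d - R.card) else 0) - beta (R.card + 1) (d - R.card) := by
    intro i
    split_ifs with hi
    · rw [firstOrderValue_diracGame_of_mem hE hd (d - R.card) R (by omega) i hi,
        ← beta_succ_add_beta_succ hR hb]
      ring
    · rw [firstOrderValue_diracGame_of_notMem hE hd hi]
      ring
  have hbeta : beta (R.card + 1) (d - R.card) = (R.card : ℝ) / d * beta R.card (d - R.card) := by
    have h := add_mul_beta_succ_left hR hb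
    have hd0 : (0 : ℝ) < d := by positivity
    rw [Nat.cast_sub hRd.le, add_sub_cancel] at h
    field_simp
    linarith
  rw [polynomialFit_firstOrder hE.2.2.2 hd, sum_congr rfl fun i _ => hval i]
  simp only [centredIndicator, sum_sub_distrib, sum_const, nsmul_eq_mul, hbeta, diracGame,
    if_neg hR0.symm, sum_ite_mem, mul_one]
  rw [inter_comm]
  ring

end FirstOrder

/-! ### The weighting is determined by the axioms -/

section WeightingUnique

variable {d : ℕ} {E : InteractionIndex d} {μ : Finset (Fin d) → ENNReal}

theorem eq_empty_or_eq_univ_of_eq_top (hμ : IsProperWeighting μ) {S : Finset (Fin d)}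
    (hS : μ S = ⊤) : S = ∅ ∨ S = univ := by
  by_contra! h
  exact hμ.2 S (card_pos.2 h.1) (card_lt_of_ne_univ h.2) hS

theorem firstOrder_normalEquation (hF : IsFaithfulFor μ E) (hd : 1 ≤ d) (v : SetFunction d)
    (a : ℝ) (b : Fin d → ℝ) (h : ∀ S, μ S = ⊤ → a + ∑ i ∈ S, b i = 0) :
    ∑ S, (μ S).toReal * ((v S - polynomialFit (E v ⟨1, le_rfl, hd⟩) S) * (a + ∑ i ∈ S, b i))
      = 0 := by
  have h1 := ((isRegressionMinimizer_iff _ _ _).1 (hF v ⟨1, le_rfl, hd⟩)).2 (affineCoeff a b)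
    (fun S hS => by rw [polynomialFit_affineCoeff, h S hS])
  simpa only [polynomialFit_affineCoeff] using h1

/-- If `μ ∅` were finite, the residual of the Dirac game of `∅`, which vanishes at `∅`, could be
tested against its own fit `S ↦ 1 - |S| / d`. -/
theorem weight_empty_eq_top (hd : 2 ≤ d) (hμ : IsProperWeighting μ) (hF : IsFaithfulFor μ E)
    (hE : SatisfiesShapleyAxioms E) : μ ∅ = ⊤ := by
  by_contra hne
  have hd1 : 1 ≤ d := by omega
  have hd0 : (d : ℝ) ≠ 0 := by positivity
  have hval : ∀ i, firstOrderValue E hd1 (diracGame ∅) i = -(1 / (d : ℝ)) := by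
    intro i
    rw [firstOrderValue_diracGame_of_notMem hE hd1 (notMem_empty i), card_empty, zero_add,
      Nat.sub_zero, beta_comm, beta_one_right hd1]
  have key := firstOrder_normalEquation hF hd1 (diracGame ∅) 1 (fun _ => -(1 / (d : ℝ))) (by
    intro S hS
    rcases eq_empty_or_eq_univ_of_eq_top hμ hS with rfl | rfl
    · exact absurd hS hne
    · simp [hd0])
  simp only [polynomialFit_firstOrder hE.2.2.2 hd1, hval, sum_const, nsmul_eq_mul] at key
  have hterm : ∀ S : Finset (Fin d), (μ S).toReal * ((diracGame ∅ S -
      (diracGame ∅ (∅ : Finset (Fin d)) +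
      (S.card : ℝ) * -(1 / (d : ℝ)))) * (1 + (S.card : ℝ) * -(1 / (d : ℝ))))
      = -((μ S).toReal * if S = ∅ then 0 else (1 + (S.card : ℝ) * -(1 / (d : ℝ))) ^ 2) := by
    intro S
    split_ifs with h
    · subst h; simp [diracGame]
    · simp [diracGame, h]; ring
  rw [sum_congr rfl fun S _ => hterm S, sum_neg_distrib, neg_eq_zero,
    sum_eq_zero_iff_of_nonneg fun S _ => by split_ifs <;> positivity] at key
  have h0 := key {⟨0, by omega⟩} (mem_univ _)
  rw [if_neg (singleton_ne_empty _), card_singleton] at h0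
  have hw : 0 < (μ {(⟨0, by omega⟩ : Fin d)}).toReal :=
    ENNReal.toReal_pos (hμ.1 _).ne' (hμ.2 _ (by simp) (by rw [card_singleton]; omega))
  have hd2 : (2 : ℝ) ≤ d := by exact_mod_cast hd
  have h2 : (1 : ℝ) + ((1 : ℕ) : ℝ) * -(1 / (d : ℝ)) ≠ 0 := by
    have : (1 : ℝ) / d ≤ 1 / 2 := by gcongr
    push_cast
    linarith
  exact (mul_pos hw (by positivity : (0:ℝ) < ((1 : ℝ) + ((1 : ℕ) : ℝ) * -(1 / (d : ℝ))) ^ 2)).ne' h0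

/-- If `μ univ` were finite, the residual of the Dirac game of `univ`, which vanishes at `univ`,
could be tested against its own fit `S ↦ |S| / d`. -/
theorem weight_univ_eq_top (hd : 2 ≤ d) (hμ : IsProperWeighting μ) (hF : IsFaithfulFor μ E)
    (hE : SatisfiesShapleyAxioms E) : μ univ = ⊤ := by
  by_contra hne
  have hd1 : 1 ≤ d := by omega
  have hd0 : (0 : ℝ) < d := by positivity
  have hu : (∅ : Finset (Fin d)) ≠ univ := by
    intro h
    have := congrArg card h
    simp at this
    omega
  have hval : ∀ i, firstOrderValue E hd1 (diracGame univ) i = 1 / (d : ℝ) := by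
    intro i
    rw [firstOrderValue_diracGame_of_mem hE hd1 0 univ (by simp) i (mem_univ i), card_univ,
      Fintype.card_fin, Nat.sub_self, zero_add, beta_one_right hd1]
  have key := firstOrder_normalEquation hF hd1 (diracGame univ) 0 (fun _ => 1 / (d : ℝ)) (by
    intro S hS
    rcases eq_empty_or_eq_univ_of_eq_top hμ hS with rfl | rfl
    · simp
    · exact absurd hS hne)
  simp only [polynomialFit_firstOrder hE.2.2.2 hd1, hval, sum_const, nsmul_eq_mul, zero_add] at key
  have hterm : ∀ S : Finset (Fin d), (μ S).toReal * ((diracGame univ S -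
      (diracGame univ (∅ : Finset (Fin d)) +
      (S.card : ℝ) * (1 / (d : ℝ)))) * ((S.card : ℝ) * (1 / (d : ℝ))))
      = -((μ S).toReal * if S = univ then 0 else ((S.card : ℝ) * (1 / (d : ℝ))) ^ 2) := by
    intro S
    split_ifs with h
    · subst h; simp [diracGame, hu, hd0.ne']
    · simp only [diracGame, if_neg h, if_neg hu]
      ring
  rw [sum_congr rfl fun S _ => hterm S, sum_neg_distrib, neg_eq_zero,
    sum_eq_zero_iff_of_nonneg fun S _ => by split_ifs <;> positivity] at key
  have h0 := key {⟨0, by omega⟩} (mem_univ _)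
  have hsing : ({⟨0, by omega⟩} : Finset (Fin d)) ≠ univ := by
    intro h
    have := congrArg card h
    simp at this
    omega
  rw [if_neg hsing, card_singleton] at h0
  have hw : 0 < (μ {(⟨0, by omega⟩ : Fin d)}).toReal :=
    ENNReal.toReal_pos (hμ.1 _).ne' (hμ.2 _ (by simp) (by rw [card_singleton]; omega))
  exact (mul_pos hw (by positivity : (0:ℝ) < (((1 : ℕ) : ℝ) * (1 / (d : ℝ))) ^ 2)).ne' h0

theorem centredIndicator_singleton_of_ne {i j : Fin d} (h : i ≠ j) :
    centredIndicator i {j} = -(1 / (d : ℝ)) := by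
  simp [centredIndicator, h]

theorem centredIndicator_of_mem {i : Fin d} {S : Finset (Fin d)} (h : i ∈ S) :
    centredIndicator i S = 1 - (S.card : ℝ) / d := by
  simp [centredIndicator, h]

/-- The normal equation of the Dirac game of `R`, tested on a centred indicator: the weights are
expressed through the Gram matrix of the centred indicators. -/
theorem weight_mul_centredIndicator (hd : 2 ≤ d) (hμ : IsProperWeighting μ)
    (hF : IsFaithfulFor μ E) (hE : SatisfiesShapleyAxioms E) {R : Finset (Fin d)}
    (hR : 1 ≤ R.card) (hRd : R.card < d) (i : Fin d) :
    (μ R).toReal * centredIndicator i R = beta R.card (d - R.card) *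
      ∑ k ∈ R, ∑ S, (μ S).toReal * (centredIndicator k S * centredIndicator i S) := by
  have hd1 : 1 ≤ d := by omega
  have hd0 : (d : ℝ) ≠ 0 := by positivity
  have hfit : ∀ S : Finset (Fin d), (0 : ℝ) + ∑ j ∈ S, ((if j = i then 1 else 0) - 1 / (d : ℝ))
      = centredIndicator i S := by
    intro S
    rw [← polynomialFit_centredIndicator, polynomialFit_affineCoeff]
  have key := firstOrder_normalEquation hF hd1 (diracGame R) 0
    (fun j => (if j = i then 1 else 0) - 1 / (d : ℝ)) (by
      intro S hS
      rw [hfit]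
      rcases eq_empty_or_eq_univ_of_eq_top hμ hS with rfl | rfl
      · simp [centredIndicator]
      · simp [centredIndicator, hd0])
  simp only [hfit, polynomialFit_diracGame hE hd1 hR hRd] at key
  have hsplit : ∀ S : Finset (Fin d), (μ S).toReal * ((diracGame R S -
      beta R.card (d - R.card) * ∑ k ∈ R, centredIndicator k S) * centredIndicator i S)
      = (if S = R then (μ S).toReal * centredIndicator i S else 0) - beta R.card (d - R.card) *
        ∑ k ∈ R, (μ S).toReal * (centredIndicator k S * centredIndicator i S) := by
    intro S
    rw [← mul_sum, ← sum_mul, diracGame]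
    split_ifs <;> ring
  rw [sum_congr rfl fun S _ => hsplit S, sum_sub_distrib, sum_ite_eq', if_pos (mem_univ R),
    ← mul_sum, sum_comm] at key
  linarith

/-- Singletons have equal weights because the Gram matrix of the centred indicators is symmetric. -/
theorem weight_singleton_eq (hd : 2 ≤ d) (hμ : IsProperWeighting μ) (hF : IsFaithfulFor μ E)
    (hE : SatisfiesShapleyAxioms E) (i j : Fin d) : (μ {i}).toReal = (μ {j}).toReal := by
  rcases eq_or_ne i j with rfl | hij
  · rfl
  have hd0 : (0 : ℝ) < d := by positivity
  have hi := weight_mul_centredIndicator hd hμ hF hE (R := {i}) (by simp)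
    (by rw [card_singleton]; omega) j
  have hj := weight_mul_centredIndicator hd hμ hF hE (R := {j}) (by simp)
    (by rw [card_singleton]; omega) i
  rw [centredIndicator_singleton_of_ne hij.symm, sum_singleton] at hi
  rw [centredIndicator_singleton_of_ne hij, sum_singleton] at hj
  have hsymm : ∑ S, (μ S).toReal * (centredIndicator i S * centredIndicator j S)
      = ∑ S, (μ S).toReal * (centredIndicator j S * centredIndicator i S) :=
    sum_congr rfl fun S _ => by rw [mul_comm (centredIndicator i S)]
  rw [hsymm] at hi
  rw [card_singleton] at hi hj
  rw [← hj] at hi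
  exact mul_right_cancel₀ (neg_ne_zero.2 (by positivity : (1 / (d : ℝ)) ≠ 0)) hi

/-- The normal equations of singletons determine the Gram matrix, and with it all weights. -/
theorem weight_eq (hd : 2 ≤ d) (hμ : IsProperWeighting μ) (hF : IsFaithfulFor μ E)
    (hE : SatisfiesShapleyAxioms E) (j : Fin d) {R : Finset (Fin d)}
    (hR : 1 ≤ R.card) (hRd : R.card < d) :
    (μ R).toReal = (μ {j}).toReal / beta 1 (d - 1) * beta R.card (d - R.card) := by
  obtain ⟨i, hi⟩ := card_pos.1 hR
  have hb1 := beta_pos 1 (d - 1)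
  have hd0 : (0 : ℝ) < d := by positivity
  have hgram : ∀ k, ∑ S, (μ S).toReal * (centredIndicator k S * centredIndicator i S)
      = (μ {j}).toReal / beta 1 (d - 1) * centredIndicator i {k} := by
    intro k
    have h := weight_mul_centredIndicator hd hμ hF hE (R := {k}) (by simp)
      (by rw [card_singleton]; omega) i
    rw [sum_singleton, card_singleton, weight_singleton_eq hd hμ hF hE k j] at h
    rw [div_mul_eq_mul_div, h]
    field_simp
  have hsum : ∑ k ∈ R, centredIndicator i {k} = centredIndicator i R := by
    simp only [centredIndicator, mem_singleton, card_singleton, sum_sub_distrib, sum_const,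
      sum_ite_eq, nsmul_eq_mul]
    ring
  have h := weight_mul_centredIndicator hd hμ hF hE hR hRd i
  rw [sum_congr rfl fun k _ => hgram k, ← mul_sum, hsum] at h
  have hne : centredIndicator i R ≠ 0 := by
    rw [centredIndicator_of_mem hi]
    have : (R.card : ℝ) / d < 1 := by
      rw [div_lt_one hd0]
      exact_mod_cast hRd
    linarith
  refine mul_right_cancel₀ hne ?_
  rw [h]
  ring

theorem isFaithShapWeighting_of_axioms (hd : 2 ≤ d) (hμ : IsProperWeighting μ)
    (hF : IsFaithfulFor μ E) (hE : SatisfiesShapleyAxioms E) : IsFaithShapWeighting μ := by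
  refine ⟨weight_empty_eq_top hd hμ hF hE, weight_univ_eq_top hd hμ hF hE, ?_⟩
  set j : Fin d := ⟨0, by omega⟩
  have hw : 0 < (μ {j}).toReal :=
    ENNReal.toReal_pos (hμ.1 _).ne' (hμ.2 _ (by simp) (by rw [card_singleton]; omega))
  have hb1 := beta_pos 1 (d - 1)
  have hd2 : (2 : ℝ) ≤ d := by exact_mod_cast hd
  have hd1 : (0 : ℝ) < (d : ℝ) - 1 := by linarith
  have hd0 : (0 : ℝ) < (d : ℝ) := by linarith
  refine ⟨(μ {j}).toReal / beta 1 (d - 1) * (d / ((d : ℝ) - 1)), by positivity,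
    fun S hS hSd => ?_⟩
  rw [← ENNReal.ofReal_toReal (hμ.2 S hS hSd), weight_eq hd hμ hF hE j hS hSd,
    weight_eq_beta hS hSd]
  congr 1
  field_simp

/-- A Faith-Interaction index that satisfies the axioms is given by the closed form. -/
theorem eq_faithShap (hd : 1 ≤ d) (hFaith : IsFaithInteractionIndex E)
    (hE : SatisfiesShapleyAxioms E) : E = faithShap d := by
  obtain ⟨μ, hμ, hF⟩ := hFaith
  refine isFaithfulFor_unique hμ.1 hF ?_
  rcases hd.eq_or_lt with rfl | hd2
  · -- for `d = 1` the only order is `d`, and an exact fit is a minimizer for every weighting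
    intro v l
    have hl : l.1 = 1 := le_antisymm l.2.2 l.2.1
    rw [isRegressionMinimizer_iff]
    refine ⟨fun S _ => (polynomialFit_faithShap_of_eq v l hl S).symm, fun y _ => ?_⟩
    refine sum_eq_zero fun S _ => ?_
    rw [polynomialFit_faithShap_of_eq v l hl S, sub_self, zero_mul, mul_zero]
  · exact isFaithfulFor_faithShap (isFaithShapWeighting_of_axioms hd2 hμ hF hE)

theorem isFaithInteractionIndex_faithShap (d : ℕ) : IsFaithInteractionIndex (faithShap d) := by
  obtain ⟨μ, hμ⟩ := exists_isFaithShapWeighting d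
  exact ⟨μ, isProperWeighting_of_isFaithShapWeighting hμ, isFaithfulFor_faithShap hμ⟩

end WeightingUnique

end FaithShap

theorem mainTheorem1 (d : ℕ) (hd : 1 ≤ d) :
    (∃! E : InteractionIndex d, IsFaithInteractionIndex E ∧ SatisfiesShapleyAxioms E) ∧
    ∀ E : InteractionIndex d, IsFaithInteractionIndex E → SatisfiesShapleyAxioms E →
      -- its weighting function
      (∀ μ : Finset (Fin d) → ENNReal, IsFaithShapWeighting μ →
        IsProperWeighting μ ∧ ∀ E' : InteractionIndex d, IsFaithfulFor μ E' ↔ E' = E) ∧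
      (2 ≤ d → ∀ μ : Finset (Fin d) → ENNReal, IsProperWeighting μ → IsFaithfulFor μ E →
        IsFaithShapWeighting μ) ∧
      -- its closed form
      (∀ (v : SetFunction d) (l : InteractionOrder d) (S : SmallSubset d l.1),
        E v l S = moebiusTransform v S.1 +
          (-1 : ℝ) ^ (l.1 - S.1.card) * ((S.1.card : ℝ) / ((l.1 : ℝ) + (S.1.card : ℝ))) *
            (l.1.choose S.1.card : ℝ) *
            ∑ T : Finset (Fin d) with S.1 ⊂ T ∧ l.1 < T.card,
              ((T.card - 1).choose l.1 : ℝ) /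
                ((T.card + l.1 - 1).choose (l.1 + S.1.card) : ℝ) * moebiusTransform v T) ∧
      -- its top-order terms, a weighted average of discrete derivatives
      (∀ (l : InteractionOrder d) (S : SmallSubset d l.1), S.1.card = l.1 →
        (∀ T ∈ (S.1ᶜ).powerset, 0 < topOrderWeight d l.1 T.card) ∧
        ∑ T ∈ (S.1ᶜ).powerset, topOrderWeight d l.1 T.card = 1 ∧
        ∀ v : SetFunction d,
          E v l S = ∑ T ∈ (S.1ᶜ).powerset,
            topOrderWeight d l.1 T.card * discreteDerivative v S.1 T) := by
  refine ⟨⟨FaithShap.faithShap d, ⟨FaithShap.isFaithInteractionIndex_faithShap d,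
    FaithShap.faithShap_satisfiesShapleyAxioms⟩, fun E hE => FaithShap.eq_faithShap hd hE.1 hE.2⟩,
    fun E hFaith hE => ?_⟩
  obtain rfl := FaithShap.eq_faithShap hd hFaith hE
  refine ⟨fun μ hμ => ?_, fun hd2 μ hμ hF =>
    FaithShap.isFaithShapWeighting_of_axioms hd2 hμ hF hE, fun v l S => ?_, fun l S hS => ?_⟩
  · have hproper := FaithShap.isProperWeighting_of_isFaithShapWeighting hμ
    have hfaithful := FaithShap.isFaithfulFor_faithShap hμ
    refine ⟨hproper, fun E' => ⟨fun h => FaithShap.isFaithfulFor_unique hproper.1 h hfaithful, ?_⟩⟩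
    rintro rfl
    exact hfaithful
  · rw [FaithShap.faithShap, Finset.mul_sum]
    congr 1
    refine Finset.sum_congr rfl fun T _ => ?_
    rw [FaithShap.shapCoeff]
    ring
  · exact ⟨fun T _ => FaithShap.topOrderWeight_pos d l.1 T.card,
      FaithShap.sum_topOrderWeight l.2.1 hS, fun v => FaithShap.faithShap_topOrder v l S hS⟩
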